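/- For $n\ge 1$, let $p(n)$ be the maximum number $k$ such that every family $\mathcal S$ of $n$ pairwise disjoint line segments in the plane whose $2n$ endpoints are in convex position admits an alternating path among $\mathcal S$ going through exactly $k$ segments of $\mathcal S$. Here the $2n$ endpoints are in convex position if they are distinct and none of them lies in the convex hull of the others, and an alternating path among $\mathcal S$ is a simple (open) polygonal chain in which every other segment belongs to $\mathcal S$; its remaining segments may cross segments of $\mathcal S$ that are not in the chain. Then for every integer $n\ge 1$, $$p(n)=\left\lceil \sqrt{8n}-2\right\rceil .$$ Moreover, for every $n\ge 1$, this same number $\lceil\sqrt{8n}-2\rceil$ is the maximum number $k$ such that every tree with $n$ edges can be transformed, by contracting edges, into a caterpillar with exactly $k$ edges, where a caterpillar is a tree whose non-leaf vertices (the vertices of degree different from $1$) induce a path, possibly with no vertices. -/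

import Mathlib

/-- The Euclidean plane. -/
abbrev Plane : Type := EuclideanSpace ℝ (Fin 2)

/-- `a, b` describe a family of `n` pairwise disjoint segments in the plane, the `j`-th one with
endpoints `a j` and `b j`, whose `2 * n` endpoints are in (strictly) convex position. Convex
independence makes the `2 * n` endpoints distinct, so that no segment is degenerate. -/
structure IsConvexSegmentFamily {n : ℕ} (a b : Fin n → Plane) : Prop where
  convex_position : ConvexIndependent ℝ (Sum.elim a b : Fin n ⊕ Fin n → Plane)
  disjoint : ∀ i j, i ≠ j → Disjoint (segment ℝ (a i) (b i)) (segment ℝ (a j) (b j))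

/-- The points `v 0, v 1, …, v m` are the successive vertices of a simple (open) polygonal chain
with the `m` segments from `v i` to `v (i + 1)`, `i < m`: these are non-degenerate, consecutive
ones share only their common vertex, and all others are disjoint. -/
structure IsSimpleChain (v : ℕ → Plane) (m : ℕ) : Prop where
  ne : ∀ i, i < m → v i ≠ v (i + 1)
  inter_succ : ∀ i, i + 1 < m →
    segment ℝ (v i) (v (i + 1)) ∩ segment ℝ (v (i + 1)) (v (i + 2)) = {v (i + 1)}
  disjoint : ∀ i j, i + 1 < j → j < m →
    Disjoint (segment ℝ (v i) (v (i + 1))) (segment ℝ (v j) (v (j + 1)))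

/-- The segments with endpoints `a j`, `b j` admit an alternating path among them going through
`k` of them: a simple polygonal chain in which every other segment (those whose position has a
fixed parity, given by `r`) is in the family, `k` segments of the chain being of that kind. The
remaining segments of the chain may cross segments of the family that are not in the chain. -/
def AdmitsAlternatingPath {n : ℕ} (a b : Fin n → Plane) (k : ℕ) : Prop :=
  ∃ (v : ℕ → Plane) (m r : ℕ), IsSimpleChain v m ∧
    (∀ i, i < m → Even (i + r) → ∃ j, s(v i, v (i + 1)) = s(a j, b j)) ∧
    {i ∈ Finset.range m | Even (i + r)}.card = k

/-- A vertex of degree one. -/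
def IsLeafVertex {V : Type} (G : SimpleGraph V) (x : V) : Prop :=
  ∃! y, G.Adj x y

/-- A caterpillar is a tree whose non-leaf vertices induce a path
(possibly on no vertex at all, when the tree is a single edge). -/
def IsCaterpillar {V : Type} (G : SimpleGraph V) : Prop :=
  G.IsTree ∧ ∃ m : ℕ,
    Nonempty (G.induce {x | ¬ IsLeafVertex G x} ≃g SimpleGraph.pathGraph m)

/-- The graph obtained from `G` by contracting the edges in `C`: its vertices are the connected
components of the graph on the same vertices with edges `C`, and two distinct ones are adjacent
if some edge of `G` joins them. -/
def contractEdges {V : Type} (G : SimpleGraph V) (C : Set (Sym2 V)) :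
    SimpleGraph (SimpleGraph.fromEdgeSet C).ConnectedComponent :=
  G.map (SimpleGraph.fromEdgeSet C).connectedComponentMk

/-- A caterpillar with `k` edges can be obtained from `G` by contracting edges of `G`. -/
def ContractsToCaterpillar {V : Type} (G : SimpleGraph V) (k : ℕ) : Prop :=
  ∃ C : Set (Sym2 V), C ⊆ G.edgeSet ∧ IsCaterpillar (contractEdges G C) ∧
    (contractEdges G C).edgeSet.ncard = k

/-!
The number `k₀ = ⌈√(8 n) - 2⌉` arises twice in the same way. Let a tree with `n` edges have two
vertices at the largest distance `d`, and let it have `l` leaves besides them. Keeping the `d` edges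
between the two vertices and the edges at the `l` leaves, or any part of these, and contracting all
other edges yields a caterpillar. An edge off the path lies between the path and one of the `l`
leaves, and each leaf is at most `d / 2` away from the path, since otherwise it would be farther
than `d` from one end. Hence `n ≤ d + l d / 2`, that is `2 n ≤ d (l + 2)`, and the inequality of the
means gives `(d + l + 2) ^ 2 ≥ 4 d (l + 2) ≥ 8 n`, so at least `k₀` edges can be kept
(`contractsToCaterpillar_of_forall`). Distances, the diameter and the order along the path are all
expressed by the cuts of the tree into two sides that its edges define; the only facts needed are
that each edge has two sides and that cuts do not cross (`laminar`). Spiders with `l` legs of length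
at most `r` show that nothing better is possible: in a caterpillar contraction at most two legs keep
more than one edge (`spider_caterpillar_le`), so at most `2 r + l - 2` edges are kept, which is at
most `k₀` for suitable `l` and `r` with `n ≤ l r` (`exists_legs`).

Disjoint segments with endpoints in convex position form a noncrossing matching of the `2 n` points
in their cyclic order (`IsConvexSegmentFamily.exists_matching`), whose dual tree has the `n`
segments as edges; its leaves are the pairs of neighbouring points. If `D` is the smallest number
such that each `D` consecutive positions contain such a pair, then with `l + 2` pairs
`2 n ≤ D (l + 2)`, because every position has a pair among the `D` positions from it on. By
minimality, there are `D` consecutive points without such a pair among them; they belong to `D`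
different segments, which together with the at least `l` remaining pairs of neighbours play the
role of the caterpillar
(`IsNoncrossingMatching.exists_large_family`). Going backwards around the circle, and traversing
each segment when its first endpoint is met, produces an alternating path: for each edge of the
path, all later vertices are on one side of it (`admitsAlternatingPath_of_sequence`). For the upper
bound, the spider is realized by `l` groups of nested chords of a parabola; the innermost of two or
more segments of a group that a path uses must be at an end of the path, so again at most two
groups contribute more than one segment (`alternatingPath_groups_le`).
-/

/-! ### Cuts of a tree -/

/-- `Separates T e x y`: the vertices `x` and `y` are disconnected in `T` without the edge `e`. For
an edge `e` of a tree this is a cut of the vertices into two sides. -/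
def Separates {V : Type} (T : SimpleGraph V) (e : Sym2 V) (x y : V) : Prop :=
  ¬ (T.deleteEdges {e}).Reachable x y

/-- A property that passes along edges passes along reachability. -/
lemma reachable_induct {V : Type} {G : SimpleGraph V} {P : V → Prop}
    (h : ∀ u v, G.Adj u v → P u → P v) {u v : V} (huv : G.Reachable u v) (hu : P u) : P v := by
  obtain ⟨p⟩ := huv
  induction p with
  | nil => exact hu
  | cons hadj _ ih => exact ih (h _ _ hadj hu)

section Cuts

variable {V : Type} {T : SimpleGraph V} {e f : Sym2 V} {a b u v x y z : V}

lemma Separates.symm (h : Separates T e x y) : Separates T e y x := fun h' => h h'.symm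

lemma separates_comm : Separates T e x y ↔ Separates T e y x := ⟨.symm, .symm⟩

lemma not_separates_self : ¬ Separates T e x x := fun h => h .rfl

lemma not_separates_trans (h : ¬ Separates T e x y) (h' : ¬ Separates T e y z) :
    ¬ Separates T e x z := by
  simp only [Separates, not_not] at *
  exact h.trans h'

lemma not_separates_of_adj (h : T.Adj u v) (he : e ≠ s(u, v)) : ¬ Separates T e u v := by
  simp only [Separates, not_not]
  refine SimpleGraph.Adj.reachable ?_
  rw [SimpleGraph.deleteEdges_adj]
  exact ⟨h, fun h' => he h'.symm⟩

lemma separates_of_adj (hT : T.IsTree) (h : T.Adj u v) : Separates T s(u, v) u v :=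
  SimpleGraph.isAcyclic_iff_forall_adj_isBridge.1 hT.isAcyclic h

/-- An edge of a tree has only two sides. -/
lemma not_separates_of_separates (hT : T.IsTree) (he : e ∈ T.edgeSet) (hxy : Separates T e x y)
    (hxz : Separates T e x z) : ¬ Separates T e y z := by
  induction e with | h u v =>
  have key : ∀ w, (T.deleteEdges {s(u, v)}).Reachable u w ∨
      (T.deleteEdges {s(u, v)}).Reachable v w := fun w => by
    refine reachable_induct (P := fun w => (T.deleteEdges {s(u, v)}).Reachable u w ∨
      (T.deleteEdges {s(u, v)}).Reachable v w) ?_ (hT.connected.preconnected u w) (.inl .rfl)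
    intro p q hpq hp
    by_cases h : s(u, v) = s(p, q)
    · rcases Sym2.eq_iff.1 h with ⟨rfl, rfl⟩ | ⟨rfl, rfl⟩
      · exact .inr .rfl
      · exact .inl .rfl
    · have := not_separates_of_adj hpq h
      rw [Separates, not_not] at this
      exact hp.imp (·.trans this) (·.trans this)
  simp only [Separates] at *
  rw [not_not]
  rcases key x with hx | hx <;> rcases key y with hy | hy <;> rcases key z with hz | hz
  all_goals first
    | exact (hxy (hx.symm.trans hy)).elim
    | exact (hxz (hx.symm.trans hz)).elim
    | exact hy.symm.trans hz

/-- Moving a point within its side of a cut does not matter. -/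
lemma separates_congr (h : ¬ Separates T e x y) : Separates T e x z ↔ Separates T e y z := by
  refine ⟨fun h' h'' => ?_, fun h' h'' => ?_⟩
  · exact not_separates_trans h (not_not.2 h'') h'
  · exact not_separates_trans (mt Separates.symm h) (not_not.2 h'') h'

lemma separates_of_mem_edges (hT : T.IsTree) (p : T.Walk x y) (hp : p.IsPath) (he : e ∈ p.edges) :
    Separates T e x y := by
  classical
  induction e with | h u v =>
  rw [Separates, SimpleGraph.reachable_deleteEdges_iff_exists_walk]
  rintro ⟨q, hq⟩
  have h := (hT.isAcyclic.subsingleton_path x y).elim ⟨p, hp⟩ q.toPath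
  have h' : p = q.toPath := congrArg Subtype.val h
  rw [h'] at he
  exact hq (q.edges_toPath_subset_edges he)

/-- Vertices of a tree that only edges of `C` separate are connected through edges of `C`. -/
lemma reachable_fromEdgeSet (hT : T.IsTree) {C : Set (Sym2 V)}
    (h : ∀ e ∈ T.edgeSet, Separates T e x y → e ∈ C) :
    (SimpleGraph.fromEdgeSet C).Reachable x y := by
  obtain ⟨p, hp⟩ := (hT.existsUnique_path x y).exists
  refine ⟨p.transfer _ fun e he => ?_⟩
  have heT := p.edges_subset_edgeSet he
  rw [SimpleGraph.edgeSet_fromEdgeSet]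
  exact ⟨h e heT (separates_of_mem_edges hT p hp he), T.not_isDiag_of_mem_edgeSet heT⟩

/-- A side of `e` that `s(y, z)` cuts contains the end `y`. -/
lemma not_separates_end (h : ¬ Separates T e u v) (hs : Separates T s(y, z) u v) :
    ¬ Separates T e u y := by
  rw [Separates, not_not] at h ⊢
  obtain ⟨p⟩ := h
  rw [Separates, SimpleGraph.reachable_deleteEdges_iff_exists_walk] at hs
  push Not at hs
  have hy := hs (p.mapLe (SimpleGraph.deleteEdges_le _))
  rw [SimpleGraph.Walk.edges_mapLe_eq_edges] at hy
  classical
  exact ⟨p.takeUntil y (p.fst_mem_support_of_mem_edges hy)⟩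

/-- Cuts given by edges of a tree are laminar: the four intersections of sides of two of them are
not all non-empty. -/
lemma laminar (hau : Separates T e a u) (hav : ¬ Separates T e a v) (hub : ¬ Separates T e u b)
    (hfav : Separates T f a v) (hfub : Separates T f u b) : False := by
  induction f with | h y z =>
  have h1 := not_separates_end hav hfav
  have h2 := not_separates_end hub hfub
  exact not_separates_trans h1 (mt Separates.symm h2) hau

end Cuts

/-! ### Contraction of edges in a tree -/

section Contraction

variable {V : Type} {T : SimpleGraph V} {C : Set (Sym2 V)} {e : Sym2 V} {u v x y z : V}

/-- The vertex of the contracted graph that `v` becomes part of. -/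
abbrev bag (C : Set (Sym2 V)) (v : V) : (SimpleGraph.fromEdgeSet C).ConnectedComponent :=
  (SimpleGraph.fromEdgeSet C).connectedComponentMk v

lemma bag_surjective (x : (SimpleGraph.fromEdgeSet C).ConnectedComponent) : ∃ v, bag C v = x :=
  x.exists_rep

lemma bag_eq_of_mem (h : s(u, v) ∈ C) : bag C u = bag C v := by
  by_cases huv : u = v
  · rw [huv]
  · exact SimpleGraph.ConnectedComponent.sound
      (SimpleGraph.Adj.reachable ((SimpleGraph.fromEdgeSet_adj C).2 ⟨h, huv⟩))

/-- A function that agrees on the ends of each edge of `C` is constant on the components. -/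
lemma eq_of_bag_eq {α : Type*} {g : V → α} (hg : ∀ u v, s(u, v) ∈ C → g u = g v)
    (h : bag C u = bag C v) : g u = g v := by
  refine reachable_induct (P := fun w => g u = g w) (fun p q hpq hp => hp.trans ?_)
    (SimpleGraph.ConnectedComponent.exact h) rfl
  exact hg _ _ ((SimpleGraph.fromEdgeSet_adj C).1 hpq).1

lemma not_separates_of_bag_eq (hC : C ⊆ T.edgeSet) (he : e ∉ C) (h : bag C u = bag C v) :
    ¬ Separates T e u v := by
  rw [Separates, not_not]
  refine (SimpleGraph.ConnectedComponent.exact h).mono fun p q hpq => ?_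
  rw [SimpleGraph.fromEdgeSet_adj] at hpq
  rw [SimpleGraph.deleteEdges_adj]
  exact ⟨hC hpq.1, fun h' => he (h' ▸ hpq.1)⟩

lemma bag_ne_of_adj (hT : T.IsTree) (hC : C ⊆ T.edgeSet) (h : T.Adj u v) (huv : s(u, v) ∉ C) :
    bag C u ≠ bag C v :=
  fun h' => not_separates_of_bag_eq hC huv h' (separates_of_adj hT h)

lemma contractEdges_adj_iff (hT : T.IsTree) (hC : C ⊆ T.edgeSet)
    {x y : (SimpleGraph.fromEdgeSet C).ConnectedComponent} :
    (contractEdges T C).Adj x y ↔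
      ∃ u v, T.Adj u v ∧ s(u, v) ∉ C ∧ bag C u = x ∧ bag C v = y := by
  constructor
  · rintro ⟨hne, u, v, h, rfl, rfl⟩
    exact ⟨u, v, h, fun h' => hne (bag_eq_of_mem h'), rfl, rfl⟩
  · rintro ⟨u, v, h, h', rfl, rfl⟩
    exact ⟨bag_ne_of_adj hT hC h h', u, v, h, rfl, rfl⟩

/-- Two kept edges that become the same edge are the same. -/
lemma contracted_edge_inj (hT : T.IsTree) (hC : C ⊆ T.edgeSet) (huv : T.Adj u v)
    (hxy : T.Adj x y) (hK : s(u, v) ∉ C)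
    (h : s(bag C u, bag C v) = s(bag C x, bag C y)) : s(u, v) = s(x, y) := by
  by_contra hne
  have hs := separates_of_adj hT huv
  have hn := not_separates_of_adj hxy hne
  rcases Sym2.eq_iff.1 h with ⟨h1, h2⟩ | ⟨h1, h2⟩
  · exact not_separates_trans (not_separates_trans (not_separates_of_bag_eq hC hK h1) hn)
      (not_separates_of_bag_eq hC hK h2.symm) hs
  · exact not_separates_trans (not_separates_trans (not_separates_of_bag_eq hC hK h1)
      (mt Separates.symm hn)) (not_separates_of_bag_eq hC hK h2.symm) hs

lemma contractEdges_isTree (hT : T.IsTree) (hC : C ⊆ T.edgeSet) : (contractEdges T C).IsTree := by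
  have hne : Nonempty (SimpleGraph.fromEdgeSet C).ConnectedComponent :=
    hT.connected.nonempty.map (bag C)
  refine ⟨⟨fun x y => ?_⟩, ?_⟩
  · obtain ⟨u, rfl⟩ := bag_surjective x
    obtain ⟨v, rfl⟩ := bag_surjective y
    refine reachable_induct (P := fun w => (contractEdges T C).Reachable (bag C u) (bag C w)) ?_
      (hT.connected.preconnected u v) .rfl
    intro p q hpq hp
    by_cases h : s(p, q) ∈ C
    · rwa [← bag_eq_of_mem h]
    · exact hp.trans (SimpleGraph.Adj.reachable
        ((contractEdges_adj_iff hT hC).2 ⟨p, q, hpq, h, rfl, rfl⟩))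
  · rw [SimpleGraph.isAcyclic_iff_forall_adj_isBridge]
    intro x y hxy
    obtain ⟨u, v, huv, hK, rfl, rfl⟩ := (contractEdges_adj_iff hT hC).1 hxy
    rw [SimpleGraph.isBridge_iff]
    intro h
    -- The side of the cut by `s(u, v)` is a well-defined function on the contracted graph.
    have := reachable_induct
      (P := fun z => ∀ w, bag C w = z → ¬ Separates T s(u, v) u w) ?_ h
      (fun w hw => not_separates_of_bag_eq hC hK hw.symm) v rfl
    · exact this (separates_of_adj hT huv)
    · intro p q hpq hp w hw
      rw [SimpleGraph.deleteEdges_adj] at hpq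
      obtain ⟨p', q', hpq', -, rfl, rfl⟩ := (contractEdges_adj_iff hT hC).1 hpq.1
      have hne : s(u, v) ≠ s(p', q') := by
        intro h'
        apply hpq.2
        rw [Set.mem_singleton_iff]
        rcases Sym2.eq_iff.1 h' with ⟨rfl, rfl⟩ | ⟨rfl, rfl⟩
        · rfl
        · exact Sym2.eq_swap
      exact not_separates_trans (not_separates_trans (hp p' rfl) (not_separates_of_adj hpq' hne))
        (not_separates_of_bag_eq hC hK hw.symm)

/-- The edges of the contracted tree are the edges that are not contracted. -/
lemma contractEdges_ncard_edgeSet (hT : T.IsTree) (hC : C ⊆ T.edgeSet) :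
    (contractEdges T C).edgeSet.ncard = (T.edgeSet \ C).ncard := by
  have h : (contractEdges T C).edgeSet = Sym2.map (bag C) '' (T.edgeSet \ C) := by
    ext e
    induction e with | h x y =>
    rw [SimpleGraph.mem_edgeSet, contractEdges_adj_iff hT hC, Set.mem_image]
    constructor
    · rintro ⟨u, v, h, hK, rfl, rfl⟩
      exact ⟨s(u, v), ⟨h, hK⟩, rfl⟩
    · rintro ⟨e, ⟨he, hK⟩, h⟩
      induction e with | h u v =>
      rw [Sym2.map_mk] at h
      rcases Sym2.eq_iff.1 h with ⟨h1, h2⟩ | ⟨h1, h2⟩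
      · exact ⟨u, v, he, hK, h1, h2⟩
      · exact ⟨v, u, T.adj_symm he, by rwa [Sym2.eq_swap], h2, h1⟩
  rw [h]
  refine Set.InjOn.ncard_image ?_
  intro e he f hf hef
  induction e with | h u v =>
  induction f with | h x y =>
  exact contracted_edge_inj hT hC he.1 hf.1 he.2 hef

end Contraction

/-! ### Caterpillars -/

/-- A connected graph on which an injective integer-valued function changes by exactly one along
each edge is a path. -/
lemma exists_iso_pathGraph {W : Type} [Finite W] {H : SimpleGraph W} (hH : H.Preconnected)
    (g : W → ℕ) (hg : Function.Injective g)
    (hadj : ∀ x y, H.Adj x y → g x + 1 = g y ∨ g y + 1 = g x) :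
    ∃ m : ℕ, Nonempty (H ≃g SimpleGraph.pathGraph m) := by
  classical
  have := Fintype.ofFinite W
  rcases isEmpty_or_nonempty W with hW | hW
  · exact ⟨0, ⟨⟨Equiv.equivOfIsEmpty _ _, fun {x} => hW.elim x⟩⟩⟩
  obtain ⟨x₀, hx₀⟩ := Finite.exists_min g
  have hfill : ∀ x, ∀ t ∈ Finset.Icc (g x₀) (g x), ∃ z, g z = t := fun x => by
    refine reachable_induct (P := fun x => ∀ t ∈ Finset.Icc (g x₀) (g x), ∃ z, g z = t) ?_
      (hH x₀ x) ?_
    · intro u v huv hu t ht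
      rw [Finset.mem_Icc] at ht
      by_cases h : t ≤ g u
      · exact hu t (Finset.mem_Icc.2 ⟨ht.1, h⟩)
      · exact ⟨v, by rcases hadj u v huv with h' | h' <;> omega⟩
    · intro t ht
      rw [Finset.mem_Icc] at ht
      exact ⟨x₀, by omega⟩
  have hlt : ∀ x, g x - g x₀ < Fintype.card W := fun x => by
    have h1 : Finset.Icc (g x₀) (g x) ⊆ Finset.univ.image g := fun t ht => by
      obtain ⟨z, hz⟩ := hfill x t ht
      exact Finset.mem_image.2 ⟨z, Finset.mem_univ _, hz⟩
    have h2 := (Finset.card_le_card h1).trans Finset.card_image_le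
    rw [Nat.card_Icc, Finset.card_univ] at h2
    have := hx₀ x
    omega
  let f : W → Fin (Fintype.card W) := fun x => ⟨g x - g x₀, hlt x⟩
  have hf : Function.Injective f := fun x y hxy => by
    have h : g x - g x₀ = g y - g x₀ := congrArg Fin.val hxy
    have := hx₀ x
    have := hx₀ y
    exact hg (by omega)
  have hf' : Function.Bijective f :=
    (Fintype.bijective_iff_injective_and_card f).2 ⟨hf, (Fintype.card_fin _).symm⟩
  have key : ∀ x y, g x + 1 = g y → H.Adj x y := fun x y hxy => by
    by_contra hn
    have h : g y ≤ g x := by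
      refine reachable_induct (P := fun z => g z ≤ g x) ?_ (hH x y) le_rfl
      intro u v huv hu
      by_contra hv
      have h1 : u = x := hg (by rcases hadj u v huv with h' | h' <;> omega)
      have h2 : v = y := hg (by rcases hadj u v huv with h' | h' <;> omega)
      exact hn (h1 ▸ h2 ▸ huv)
    omega
  refine ⟨_, ⟨⟨Equiv.ofBijective f hf', fun {x y} => ?_⟩⟩⟩
  rw [SimpleGraph.pathGraph_adj]
  change g x - g x₀ + 1 = g y - g x₀ ∨ g y - g x₀ + 1 = g x - g x₀ ↔ _
  have h1 := hx₀ x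
  have h2 := hx₀ y
  constructor
  · rintro (h | h)
    · exact key x y (by omega)
    · exact (key y x (by omega)).symm
  · intro h
    rcases hadj x y h with h' | h' <;> omega

/-- The vertices of a path between two vertices that are not leaves are not leaves. -/
lemma preconnected_induce_not_isLeafVertex {W : Type} {G : SimpleGraph W} (hG : G.Connected) :
    (G.induce {x | ¬ IsLeafVertex G x}).Preconnected := by
  classical
  rintro ⟨x, hx⟩ ⟨y, hy⟩
  obtain ⟨p, hp⟩ := hG.exists_isPath x y
  refine ⟨p.induce _ fun w hw => ?_⟩
  obtain ⟨i, rfl, hi⟩ := SimpleGraph.Walk.mem_support_iff_exists_getVert.1 hw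
  rcases Nat.eq_zero_or_pos i with rfl | hi0
  · simpa using hx
  rcases hi.eq_or_lt with rfl | hil
  · simpa using hy
  rintro ⟨z, -, hz⟩
  have h1 := hz _ (p.adj_getVert_succ hil)
  have h2 := p.adj_getVert_succ (i := i - 1) (by omega)
  rw [Nat.sub_add_cancel hi0] at h2
  have h3 := hz _ h2.symm
  have h4 := hp.getVert_injOn (by simp; omega) (by simp; omega) (h1.trans h3.symm)
  omega

lemma isCaterpillar_of_injective {W : Type} [Finite W] {G : SimpleGraph W} (hG : G.IsTree)
    (g : W → ℕ)
    (hg : ∀ x y, ¬ IsLeafVertex G x → ¬ IsLeafVertex G y → g x = g y → x = y)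
    (hadj : ∀ x y, ¬ IsLeafVertex G x → ¬ IsLeafVertex G y → G.Adj x y →
      g x + 1 = g y ∨ g y + 1 = g x) : IsCaterpillar G := by
  refine ⟨hG, exists_iso_pathGraph (preconnected_induce_not_isLeafVertex hG.connected)
    (fun x => g x.1) ?_ ?_⟩
  · rintro ⟨x, hx⟩ ⟨y, hy⟩ h
    exact Subtype.ext (hg x y hx hy h)
  · rintro ⟨x, hx⟩ ⟨y, hy⟩ h
    exact hadj x y hx hy h

/-! ### Contracting a tree to a path with pendant edges -/

section LeafEdges

variable {V : Type} {T : SimpleGraph V} {C : Set (Sym2 V)} {e : Sym2 V} {a b u v w x y z : V}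

lemma eq_of_not_separates_leaf (hw : IsLeafVertex T w) (h : T.Adj w x)
    (hy : ¬ Separates T s(w, x) w y) : y = w := by
  rw [Separates, not_not] at hy
  refine reachable_induct (P := (· = w)) ?_ hy rfl
  rintro p q hpq rfl
  rw [SimpleGraph.deleteEdges_adj] at hpq
  exact (hpq.2 (by rw [hw.unique hpq.1 h]; rfl)).elim

/-- The edge at a leaf separates nothing but that leaf from the rest. -/
lemma eq_or_eq_of_separates_leaf (hT : T.IsTree) (hw : IsLeafVertex T w) (h : T.Adj w x)
    (hyz : Separates T s(w, x) y z) : y = w ∨ z = w := by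
  by_contra! hne
  have hy := mt (eq_of_not_separates_leaf hw h) hne.1
  have hz := mt (eq_of_not_separates_leaf hw h) hne.2
  rw [not_not] at hy hz
  exact not_separates_of_separates hT h hy hz hyz

lemma isLeafVertex_bag (hT : T.IsTree) (hC : C ⊆ T.edgeSet) (hw : IsLeafVertex T w)
    (h : T.Adj w x) (hK : s(w, x) ∉ C) : IsLeafVertex (contractEdges T C) (bag C w) := by
  refine ⟨bag C x, (contractEdges_adj_iff hT hC).2 ⟨w, x, h, hK, rfl, rfl⟩, fun y hy => ?_⟩
  obtain ⟨p, q, hpq, hpq', hp, rfl⟩ := (contractEdges_adj_iff hT hC).1 hy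
  have hpw : p = w := by
    refine reachable_induct (P := (· = w)) ?_ (SimpleGraph.ConnectedComponent.exact hp.symm) rfl
    rintro r s hrs rfl
    rw [SimpleGraph.fromEdgeSet_adj] at hrs
    have hs : T.Adj r s := hC hrs.1
    rw [hw.unique hs h] at hrs
    exact (hK hrs.1).elim
  subst hpw
  rw [hw.unique hpq h]

/-- If all edges that are kept either separate `a` from `b`, and so lie on the path between them,
or end in a leaf, then the contracted tree is a caterpillar: its non-leaf vertices are ordered by
the number of kept edges on the way from `a` that separate them from `a`. -/
lemma isCaterpillar_contractEdges [Finite V] (hT : T.IsTree) (hC : C ⊆ T.edgeSet) (a b : V)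
    (hK : ∀ e ∈ T.edgeSet, e ∉ C → Separates T e a b ∨
      ∃ w x, IsLeafVertex T w ∧ T.Adj w x ∧ e = s(w, x)) :
    IsCaterpillar (contractEdges T C) := by
  classical
  have := Fintype.ofFinite V
  let S : V → Finset (Sym2 V) := fun v =>
    {e | e ∈ T.edgeSet ∧ e ∉ C ∧ Separates T e a b ∧ Separates T e a v}
  have hS : ∀ v e, e ∈ S v ↔ e ∈ T.edgeSet ∧ e ∉ C ∧ Separates T e a b ∧ Separates T e a v :=
    fun v e => by simp [S]
  have hSC : ∀ u v, s(u, v) ∈ C → S u = S v := by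
    intro u v huv
    ext e
    rw [hS, hS]
    refine and_congr_right fun _ => and_congr_right fun he => and_congr_right fun _ => ?_
    have := not_separates_of_adj (hC huv) (e := e) (by rintro rfl; exact he huv)
    rw [separates_comm, separates_congr this, separates_comm]
  have hout : ∀ v, S (bag C v).out = S v := fun v => eq_of_bag_eq hSC (Quot.out_eq _)
  -- Kept edges on the path from `a` to `b` increase the count by one.
  have hstep : ∀ p q, T.Adj p q → s(p, q) ∉ C → Separates T s(p, q) a b →
      ¬ Separates T s(p, q) a p → (S p).card + 1 = (S q).card := by
    intro p q hpq hpqC hab hap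
    have haq : Separates T s(p, q) a q := (separates_congr hap).2 (separates_of_adj hT hpq)
    have hmem : s(p, q) ∉ S p := fun h => hap ((hS _ _).1 h).2.2.2
    rw [← Finset.card_insert_of_notMem hmem]
    congr 1
    ext e
    rw [Finset.mem_insert, hS, hS]
    by_cases he : e = s(p, q)
    · subst he
      simp only [true_or, true_iff]
      exact ⟨hpq, hpqC, hab, haq⟩
    · have := not_separates_of_adj hpq he
      rw [separates_comm (x := a) (y := p), separates_comm (x := a) (y := q), separates_congr this]
      simp [he]
  refine isCaterpillar_of_injective (contractEdges_isTree hT hC) (fun x => (S x.out).card) ?_ ?_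
  · intro x y hx hy hxy
    obtain ⟨u, rfl⟩ := bag_surjective x
    obtain ⟨v, rfl⟩ := bag_surjective y
    simp only [hout] at hxy
    by_contra hne
    obtain ⟨e, he, huv, heC⟩ : ∃ e ∈ T.edgeSet, Separates T e u v ∧ e ∉ C := by
      by_contra! h
      exact hne (SimpleGraph.ConnectedComponent.sound (reachable_fromEdgeSet hT h))
    have hab : Separates T e a b := by
      refine (hK e he heC).resolve_right ?_
      rintro ⟨w, z, hw, hwz, rfl⟩
      have hl := isLeafVertex_bag hT hC hw hwz heC
      rcases eq_or_eq_of_separates_leaf hT hw hwz huv with rfl | rfl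
      · exact hx hl
      · exact hy hl
    have hchain : S u ⊆ S v ∨ S v ⊆ S u := by
      by_contra! h
      obtain ⟨f₁, h1, h1'⟩ := Finset.not_subset.1 h.1
      obtain ⟨f₂, h2, h2'⟩ := Finset.not_subset.1 h.2
      rw [hS] at h1 h2 h1' h2'
      have h1a : ¬ Separates T f₁ a v := fun h => h1' ⟨h1.1, h1.2.1, h1.2.2.1, h⟩
      have h2a : ¬ Separates T f₂ a u := fun h => h2' ⟨h2.1, h2.2.1, h2.2.2.1, h⟩
      exact laminar h1.2.2.2 h1a (not_separates_of_separates hT h1.1 h1.2.2.2 h1.2.2.1)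
        h2.2.2.2 ((separates_congr h2a).1 h2.2.2.1)
    have heq : S u = S v := by
      rcases hchain with h | h
      · exact Finset.eq_of_subset_of_card_le h hxy.ge
      · exact (Finset.eq_of_subset_of_card_le h hxy.le).symm
    have h1 : Separates T e a u ↔ Separates T e a v := by
      have := congrArg (e ∈ ·) heq
      simpa [hS, he, heC, hab] using this
    by_cases h2 : Separates T e a u
    · exact not_separates_of_separates hT he h2 (h1.1 h2) huv
    · exact h2 (h1.2 ((separates_congr h2).2 huv))
  · intro x y hx hy hxy
    obtain ⟨p, q, hpq, hpqC, rfl, rfl⟩ := (contractEdges_adj_iff hT hC).1 hxy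
    simp only [hout]
    have hab : Separates T s(p, q) a b := by
      refine (hK _ hpq hpqC).resolve_right ?_
      rintro ⟨w, z, hw, hwz, h⟩
      rw [h] at hpqC
      have hl := isLeafVertex_bag hT hC hw hwz hpqC
      rcases Sym2.eq_iff.1 h with ⟨rfl, rfl⟩ | ⟨rfl, rfl⟩
      · exact hx hl
      · exact hy hl
    by_cases hap : Separates T s(p, q) a p
    · refine .inr (hstep q p hpq.symm ?_ ?_ ?_) <;> rw [Sym2.eq_swap]
      · exact hpqC
      · exact hab
      · exact fun h => not_separates_of_separates hT hpq hap h (separates_of_adj hT hpq)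
    · exact .inl (hstep p q hpq hpqC hab hap)

end LeafEdges

/-! ### Diameter and leaves of a tree -/

section Diameter

variable {V : Type} [Finite V] {T : SimpleGraph V} {e : Sym2 V} {a b u v w x y z : V}

open Classical in
/-- The edges of `T` that separate `x` from `y`; if `T` is a tree these are the edges of the path
between them, and their number is the distance. -/
noncomputable def sepEdges (T : SimpleGraph V) (x y : V) : Finset (Sym2 V) :=
  {e ∈ T.edgeSet.toFinite.toFinset | Separates T e x y}

lemma mem_sepEdges : e ∈ sepEdges T x y ↔ e ∈ T.edgeSet ∧ Separates T e x y := by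
  simp [sepEdges]

/-- Beyond each edge there is a leaf, for instance the vertex farthest from `a`. -/
lemma exists_isLeafVertex_separates (hT : T.IsTree) (he : e ∈ T.edgeSet) (a : V) :
    ∃ w, IsLeafVertex T w ∧ Separates T e a w := by
  classical
  have hne : {w | Separates T e a w}.Nonempty := by
    induction e with | h u v =>
    by_contra h
    rw [Set.not_nonempty_iff_eq_empty, Set.eq_empty_iff_forall_notMem] at h
    exact not_separates_trans (mt Separates.symm (h u)) (h v) (separates_of_adj hT he)
  obtain ⟨w, hw, hmax⟩ := Set.exists_max_image {w | Separates T e a w}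
    (fun w => (sepEdges T a w).card) (Set.toFinite _) hne
  refine ⟨w, ?_, hw⟩
  -- Otherwise, following an edge away from `a` would lead to a vertex farther from `a`.
  have hsep : ∀ x, T.Adj w x → Separates T s(w, x) a w := by
    intro x hx
    by_contra hn
    have hne : e ≠ s(w, x) := by rintro rfl; exact hn hw
    have hex : Separates T e a x :=
      ((separates_congr (not_separates_of_adj hx hne)).1 hw.symm).symm
    have hlt : sepEdges T a w ⊂ sepEdges T a x := by
      rw [Finset.ssubset_iff_of_subset]
      · refine ⟨s(w, x), mem_sepEdges.2 ⟨hx, ?_⟩, fun h => hn (mem_sepEdges.1 h).2⟩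
        exact (separates_congr hn).2 (separates_of_adj hT hx)
      · intro f hf
        rw [mem_sepEdges] at hf ⊢
        have hfne : f ≠ s(w, x) := by rintro rfl; exact hn hf.2
        exact ⟨hf.1, ((separates_congr (not_separates_of_adj hx hfne)).1 hf.2.symm).symm⟩
    exact absurd (hmax x hex) (not_le.2 (Finset.card_lt_card hlt))
  have hnbr : ∃ x, T.Adj w x := by
    have hwa : w ≠ a := by rintro rfl; exact not_separates_self hw
    obtain ⟨p⟩ := hT.connected.preconnected w a
    cases p with
    | nil => exact (hwa rfl).elim
    | cons h _ => exact ⟨_, h⟩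
  obtain ⟨x, hx⟩ := hnbr
  refine ⟨x, hx, fun y hy => ?_⟩
  by_contra hyx
  have h1 : ¬ Separates T s(w, x) y w :=
    not_separates_of_adj hy.symm (by rw [Sym2.eq_swap]; simpa [hy.ne, hx.ne'] using Ne.symm hyx)
  have h2 : ¬ Separates T s(w, y) w x := not_separates_of_adj hx (by simpa [hy.ne'] using hyx)
  refine laminar (e := s(w, x)) (f := s(w, y)) (a := a) (u := y) (v := x) (b := w) ?_ ?_ h1 ?_ ?_
  · exact ((separates_congr h1).2 (hsep x hx).symm).symm
  · exact not_separates_of_separates hT hx (hsep x hx).symm (separates_of_adj hT hx)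
  · exact ((separates_congr h2).1 (hsep y hy).symm).symm
  · exact (separates_of_adj hT hy).symm

open Classical in
/-- In a tree in which `a` and `b` have the largest distance, the distance of a vertex `w` from
the path between `a` and `b` is at most half of that. -/
lemma two_mul_card_sdiff_le (hT : T.IsTree)
    (hmax : ∀ x y, (sepEdges T x y).card ≤ (sepEdges T a b).card) (w : V) :
    2 * (sepEdges T w a \ sepEdges T a b).card ≤ (sepEdges T a b).card := by
  have h1 : (sepEdges T w a \ sepEdges T a b).card + (sepEdges T w a ∩ sepEdges T a b).card =
      (sepEdges T w a).card := Finset.card_sdiff_add_card_inter _ _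
  have h2 : (sepEdges T w b \ sepEdges T a b).card + (sepEdges T w b ∩ sepEdges T a b).card =
      (sepEdges T w b).card := Finset.card_sdiff_add_card_inter _ _
  have h3 : sepEdges T w b \ sepEdges T a b = sepEdges T w a \ sepEdges T a b := by
    ext e
    simp only [Finset.mem_sdiff, mem_sepEdges, not_and]
    constructor <;> rintro ⟨⟨he, h⟩, h'⟩ <;> refine ⟨⟨he, ?_⟩, h'⟩
    · exact ((separates_congr (h' he)).2 h.symm).symm
    · exact ((separates_congr (h' he)).1 h.symm).symm
  have h4 : (sepEdges T w a ∩ sepEdges T a b).card + (sepEdges T w b ∩ sepEdges T a b).card =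
      (sepEdges T a b).card := by
    rw [← Finset.card_union_of_disjoint]
    · congr 1
      ext e
      simp only [Finset.mem_union, Finset.mem_inter, mem_sepEdges]
      constructor
      · rintro (h | h) <;> exact h.2
      · rintro ⟨he, h⟩
        by_cases hwa : Separates T e w a
        · exact .inl ⟨⟨he, hwa⟩, he, h⟩
        · exact .inr ⟨⟨he, (separates_congr hwa).2 h⟩, he, h⟩
    · rw [Finset.disjoint_left]
      intro e h h'
      simp only [Finset.mem_inter, mem_sepEdges] at h h'
      exact not_separates_of_separates hT h.1.1 h.1.2 h'.1.2 h.2.2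
  have h5 := hmax w a
  have h6 := hmax w b
  rw [h3] at h2
  omega

/-- A tree with `n` edges has two vertices at some distance `d` and `l` leaves other than these
such that `2 n ≤ d (l + 2)`: each edge off the path between two vertices at maximal distance lies
on the way from the path to one of the other leaves, which consists of at most `d / 2` edges. The
`d` edges of the path and the `l` edges at the leaves are different. -/
lemma exists_many_path_or_leaf_edges (hT : T.IsTree) :
    ∃ (a b : V) (d l : ℕ) (K : Finset (Sym2 V)), ↑K ⊆ T.edgeSet ∧
      (∀ e ∈ K, Separates T e a b ∨ ∃ w x, IsLeafVertex T w ∧ T.Adj w x ∧ e = s(w, x)) ∧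
      d + l ≤ K.card ∧ 2 * T.edgeSet.ncard ≤ d * (l + 2) := by
  classical
  have := Fintype.ofFinite V
  have := hT.connected.nonempty
  obtain ⟨⟨a, b⟩, hmax⟩ := Finite.exists_max fun p : V × V => (sepEdges T p.1 p.2).card
  replace hmax : ∀ x y, (sepEdges T x y).card ≤ (sepEdges T a b).card := fun x y => hmax (x, y)
  let L : Finset V := {w | IsLeafVertex T w ∧ w ≠ a ∧ w ≠ b}
  have hL : ∀ w, w ∈ L ↔ IsLeafVertex T w ∧ w ≠ a ∧ w ≠ b := fun w => by simp [L]
  have hnbr : ∀ w, ∃ x, w ∈ L → T.Adj w x := fun w => by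
    by_cases hw : w ∈ L
    · obtain ⟨x, hx, -⟩ := ((hL w).1 hw).1
      exact ⟨x, fun _ => hx⟩
    · exact ⟨w, fun h => (hw h).elim⟩
  choose nbr hnbr using hnbr
  have hinj : Set.InjOn (fun w => s(w, nbr w)) L := by
    intro w hw w' hw' h
    rcases Sym2.eq_iff.1 h with ⟨h, -⟩ | ⟨h, h'⟩
    · exact h
    by_contra
    -- Two leaves with the same edge make up the whole tree.
    have hadj := hnbr w hw
    have hadj' := hnbr w' hw'
    obtain ⟨hl, hwa, -⟩ := (hL w).1 hw
    obtain ⟨hl', hwa', -⟩ := (hL w').1 hw'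
    rw [h'] at hadj
    rw [← h] at hadj'
    have h1 := mt (eq_of_not_separates_leaf hl hadj) hwa.symm
    have h2 := mt (eq_of_not_separates_leaf hl' hadj') hwa'.symm
    rw [not_not] at h1 h2
    rw [Sym2.eq_swap] at h2
    exact not_separates_of_separates hT hadj h1.symm h2.symm (separates_of_adj hT hadj)
  have hdisj : Disjoint (sepEdges T a b) (L.image fun w => s(w, nbr w)) := by
    rw [Finset.disjoint_right]
    intro e he h
    obtain ⟨w, hw, rfl⟩ := Finset.mem_image.1 he
    obtain ⟨hl, hwa, hwb⟩ := (hL w).1 hw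
    rcases eq_or_eq_of_separates_leaf hT hl (hnbr w hw) (mem_sepEdges.1 h).2 with h' | h'
    · exact hwa h'.symm
    · exact hwb h'.symm
  refine ⟨a, b, (sepEdges T a b).card, L.card,
    sepEdges T a b ∪ L.image fun w => s(w, nbr w), ?_, ?_, ?_, ?_⟩
  · intro e he
    rw [Finset.mem_coe, Finset.mem_union] at he
    rcases he with he | he
    · exact (mem_sepEdges.1 he).1
    · obtain ⟨w, hw, rfl⟩ := Finset.mem_image.1 he
      exact hnbr w hw
  · intro e he
    rcases Finset.mem_union.1 he with he | he
    · exact .inl (mem_sepEdges.1 he).2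
    · obtain ⟨w, hw, rfl⟩ := Finset.mem_image.1 he
      exact .inr ⟨w, nbr w, ((hL w).1 hw).1, hnbr w hw, rfl⟩
  · rw [Finset.card_union_of_disjoint hdisj, Finset.card_image_of_injOn hinj]
  · have hcover : T.edgeSet.toFinite.toFinset ⊆
        sepEdges T a b ∪ L.biUnion fun w => sepEdges T w a \ sepEdges T a b := by
      intro e he
      rw [Set.Finite.mem_toFinset] at he
      by_cases hab : Separates T e a b
      · exact Finset.mem_union_left _ (mem_sepEdges.2 ⟨he, hab⟩)
      · obtain ⟨w, hw, haw⟩ := exists_isLeafVertex_separates hT he a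
        refine Finset.mem_union_right _ (Finset.mem_biUnion.2 ⟨w, (hL w).2 ⟨hw, ?_, ?_⟩, ?_⟩)
        · rintro rfl
          exact not_separates_self haw
        · rintro rfl
          exact hab haw
        · rw [Finset.mem_sdiff, mem_sepEdges, mem_sepEdges]
          exact ⟨⟨he, haw.symm⟩, fun h => hab h.2⟩
    have h1 := (Finset.card_le_card hcover).trans (Finset.card_union_le _ _)
    have h2 : 2 * (L.biUnion fun w => sepEdges T w a \ sepEdges T a b).card ≤
        L.card * (sepEdges T a b).card := by
      refine (Nat.mul_le_mul_left 2 Finset.card_biUnion_le).trans ?_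
      rw [Finset.mul_sum, ← smul_eq_mul]
      exact Finset.sum_le_card_nsmul _ _ _ fun w _ => two_mul_card_sdiff_le hT hmax w
    rw [Set.ncard_eq_toFinset_card _ (Set.toFinite _)]
    nlinarith

/-- A tree with `n` edges contracts to a caterpillar with `k` edges if `d + l - 2 ≥ k` for all
`d` and `l` with `2 n ≤ d l`. -/
lemma contractsToCaterpillar_of_forall {k : ℕ} (hT : T.IsTree)
    (hk : ∀ d l, 2 * T.edgeSet.ncard ≤ d * (l + 2) → k ≤ d + l) : ContractsToCaterpillar T k := by
  obtain ⟨a, b, d, l, K, hKT, hK, hcard, h2⟩ := exists_many_path_or_leaf_edges hT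
  obtain ⟨K', hK', hK'card⟩ := Finset.exists_subset_card_eq ((hk d l h2).trans hcard)
  have hC : T.edgeSet \ ↑K' ⊆ T.edgeSet := Set.sdiff_subset
  refine ⟨T.edgeSet \ ↑K', hC, isCaterpillar_contractEdges hT hC a b fun e he heC => ?_, ?_⟩
  · exact hK e (hK' (by simpa [he] using heC))
  · rw [contractEdges_ncard_edgeSet hT hC, Set.sdiff_sdiff_cancel_left, Set.ncard_coe_finset,
      hK'card]
    exact (Finset.coe_subset.2 hK').trans hKT

end Diameter

/-! ### Counting in the legs of a spider -/

/-- If all but two residue classes modulo `l` contain at most one element of a set of numbers below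
`l * r`, then the set has at most `2 * r + l - 2` elements. -/
lemma card_add_two_le_of_legs {l r : ℕ} (hr : 1 ≤ r) {S : Finset ℕ}
    (hS : ∀ v ∈ S, v < l * r) {B : Finset ℕ} (hB : B.card ≤ 2)
    (h : ∀ j ∉ B, {v ∈ S | v % l = j}.card ≤ 1) (hl : 1 ≤ l) : S.card + 2 ≤ 2 * r + l := by
  have hfib : ∀ j ∈ Finset.range l,
      {v ∈ S | v % l = j}.card ≤ 1 + if j ∈ B then r - 1 else 0 := by
    intro j _
    split_ifs with hj
    · have h1 : {v ∈ S | v % l = j}.card ≤ (Finset.range r).card := by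
        refine Finset.card_le_card_of_injOn (· / l) ?_ ?_
        · intro v hv
          rw [Finset.mem_coe, Finset.mem_filter] at hv
          rw [Finset.mem_coe, Finset.mem_range]
          exact Nat.div_lt_of_lt_mul (hS v hv.1)
        · intro v hv w hw hvw
          rw [Finset.mem_coe, Finset.mem_filter] at hv hw
          rw [← Nat.div_add_mod v l, ← Nat.div_add_mod w l, hv.2, hw.2]
          simp only at hvw
          rw [hvw]
      rw [Finset.card_range] at h1
      omega
    · exact h j hj
  have h1 : S.card = ∑ j ∈ Finset.range l, {v ∈ S | v % l = j}.card :=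
    Finset.card_eq_sum_card_fiberwise fun v _ => by
      simpa using Nat.mod_lt v hl
  have h2 : ∑ j ∈ Finset.range l, (if j ∈ B then r - 1 else 0) ≤ 2 * (r - 1) := by
    rw [← Finset.sum_filter, Finset.sum_const, smul_eq_mul]
    refine Nat.mul_le_mul_right _ (le_trans (Finset.card_le_card ?_) hB)
    intro j hj
    exact (Finset.mem_filter.1 hj).2
  have h3 := Finset.sum_le_sum hfib
  rw [← h1, Finset.sum_add_distrib, Finset.sum_const, Finset.card_range, smul_eq_mul] at h3
  omega

/-! ### Caterpillars obtained from a spider -/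

/-- The spider with `n` edges whose `l` legs are as equal in length as possible. The centre is `0`;
the parent of a vertex `v ≠ 0` is `v - l`, where truncated subtraction makes the centre
the parent of `1, …, l`. -/
def spider (n l : ℕ) : SimpleGraph (Fin (n + 1)) :=
  SimpleGraph.fromRel fun u v => v.val = u.val - l

/-- The parent of the vertex `w + 1` of a spider. -/
def spiderParent {n : ℕ} (l : ℕ) (w : Fin n) : Fin (n + 1) := ⟨w.val + 1 - l, by omega⟩

/-- The edge of a spider from the vertex `w + 1` to its parent. -/
def spiderEdge {n : ℕ} (l : ℕ) (w : Fin n) : Sym2 (Fin (n + 1)) := s(w.succ, spiderParent l w)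

section Spider

variable {n l : ℕ}

lemma spider_adj_parent (hl : 1 ≤ l) (w : Fin n) : (spider n l).Adj w.succ (spiderParent l w) := by
  rw [spider, SimpleGraph.fromRel_adj]
  refine ⟨fun h => ?_, .inl (by simp [spiderParent])⟩
  have := congrArg Fin.val h
  simp only [Fin.val_succ, spiderParent] at this
  omega

lemma spiderEdge_injective (hl : 1 ≤ l) : Function.Injective (spiderEdge (n := n) l) := by
  intro v w h
  rcases Sym2.eq_iff.1 h with ⟨h, -⟩ | ⟨h, h'⟩
  · exact Fin.succ_injective _ h
  · have h1 := congrArg Fin.val h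
    have h2 := congrArg Fin.val h'
    simp only [Fin.val_succ, spiderParent] at h1 h2
    omega

lemma spider_edgeSet (hl : 1 ≤ l) : (spider n l).edgeSet = Set.range (spiderEdge l) := by
  have key : ∀ u v : Fin (n + 1), u ≠ v → v.val = u.val - l → ∃ w, spiderEdge l w = s(u, v) := by
    intro u v huv h
    have hu : u ≠ 0 := by
      rintro rfl
      exact huv (Fin.ext (by simp [h]))
    obtain ⟨w, rfl⟩ := Fin.exists_succ_eq.2 hu
    refine ⟨w, ?_⟩
    rw [spiderEdge]
    congr 2
    exact Fin.ext (by simpa [spiderParent] using h.symm)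
  ext e
  induction e with | h u v =>
  rw [Set.mem_range]
  constructor
  · intro h
    rw [SimpleGraph.mem_edgeSet, spider, SimpleGraph.fromRel_adj] at h
    rcases h.2 with h' | h'
    · exact key u v h.1 h'
    · rw [Sym2.eq_swap]
      exact key v u h.1.symm h'
  · rintro ⟨w, hw⟩
    rw [← hw]
    exact spider_adj_parent hl w

lemma spider_ncard_edgeSet (hl : 1 ≤ l) : (spider n l).edgeSet.ncard = n := by
  rw [spider_edgeSet hl, ← Set.image_univ, Set.ncard_image_of_injective _ (spiderEdge_injective hl),
    Set.ncard_univ, Nat.card_fin]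

lemma spider_isTree (hl : 1 ≤ l) : (spider n l).IsTree := by
  rw [SimpleGraph.isTree_iff_connected_and_card, Nat.card_coe_set_eq, spider_ncard_edgeSet hl,
    Nat.card_fin]
  refine ⟨?_, rfl⟩
  rw [SimpleGraph.connected_iff_exists_forall_reachable]
  refine ⟨0, fun v => ?_⟩
  obtain ⟨k, hk⟩ := v
  induction k using Nat.strong_induction_on with | _ k ih =>
  rcases Nat.eq_zero_or_pos k with rfl | hk0
  · exact .rfl
  · have h1 := ih (k - l) (by omega) (by omega)
    have h2 := spider_adj_parent hl (⟨k - 1, by omega⟩ : Fin n)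
    have h3 : spiderParent l (⟨k - 1, by omega⟩ : Fin n) = (⟨k - l, by omega⟩ : Fin (n + 1)) :=
      Fin.ext (by simp only [spiderParent]; omega)
    have h4 : (⟨k - 1, by omega⟩ : Fin n).succ = ⟨k, hk⟩ := Fin.ext (by simp; omega)
    rw [h3, h4] at h2
    exact h1.trans h2.symm.reachable

open Classical in
/-- For a vertex `v` of a spider that some edges in `K` separate from the centre, its leg and the
number of these edges; otherwise `(0, 0)`. An edge is given by `w` if it joins `w + 1` to its
parent, so that the leg of `v` is the residue class of `v - 1`. -/
noncomputable def legPosition (l : ℕ) (K : Finset (Fin n)) (v : Fin (n + 1)) : ℕ × ℕ :=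
  let c := {w ∈ K | w.val % l = (v.val - 1) % l ∧ w.val < v.val}.card
  if c = 0 then (0, 0) else ((v.val - 1) % l, c)

lemma legPosition_parent {K : Finset (Fin n)} {w : Fin n} (hl : 1 ≤ l) (hw : w ∉ K) :
    legPosition l K w.succ = legPosition l K (spiderParent l w) := by
  have hne : ∀ w' ∈ K, w'.val ≠ w.val := fun w' hw' h => hw (Fin.ext h ▸ hw')
  rcases lt_or_ge w.val l with hwl | hwl
  · have h1 : {w' ∈ K | w'.val % l = (w.succ.val - 1) % l ∧ w'.val < w.succ.val} = ∅ := by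
      rw [Finset.filter_eq_empty_iff]
      rintro w' hw' ⟨h1, h2⟩
      rw [Fin.val_succ] at h1 h2
      rw [Nat.mod_eq_of_lt (by omega), Nat.mod_eq_of_lt (by omega)] at h1
      exact hne w' hw' (by omega)
    have h2 : {w' ∈ K | w'.val % l = ((spiderParent l w).val - 1) % l ∧
        w'.val < (spiderParent l w).val} = ∅ := by
      rw [Finset.filter_eq_empty_iff]
      rintro w' hw' ⟨-, h2⟩
      simp only [spiderParent] at h2
      omega
    simp only [legPosition, h1, h2, Finset.card_empty, if_true]
  · have h0 : (w.val + 1 - l - 1) % l = w.val % l := by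
      rw [Nat.sub_right_comm, Nat.add_sub_cancel, ← Nat.mod_eq_sub_mod hwl]
    have h1 : {w' ∈ K | w'.val % l = (w.succ.val - 1) % l ∧ w'.val < w.succ.val} =
        {w' ∈ K | w'.val % l = ((spiderParent l w).val - 1) % l ∧
          w'.val < (spiderParent l w).val} := by
      refine Finset.filter_congr fun w' hw' => ?_
      simp only [Fin.val_succ, spiderParent, Nat.add_sub_cancel, h0]
      refine and_congr_right fun h => ⟨fun h' => ?_, fun h' => by omega⟩
      by_contra hn
      have h2 := hne w' hw'
      -- Now `w - l < w' < w`, too close for equal residues.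
      have h3 : l ∣ w.val - w'.val := (Nat.modEq_iff_dvd' (by omega)).1 h
      have := Nat.le_of_dvd (by omega) h3
      omega
    simp only [legPosition, h1]
    simp only [Fin.val_succ, spiderParent, Nat.add_sub_cancel, h0]

lemma exists_neighbor_of_leg (hl : 1 ≤ l) {C : Set (Sym2 (Fin (n + 1)))}
    (hC : C ⊆ (spider n l).edgeSet) {K : Finset (Fin n)} (hK : ∀ w, w ∈ K ↔ spiderEdge l w ∉ C)
    {j : ℕ} (hj : 2 ≤ {w ∈ K | w.val % l = j}.card) :
    ∃ v u, legPosition l K v = (j, 1) ∧ legPosition l K u = (j, 2) ∧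
      (contractEdges (spider n l) C).Adj (bag C 0) (bag C v) ∧
      (contractEdges (spider n l) C).Adj (bag C v) (bag C u) := by
  classical
  have hT := spider_isTree (n := n) hl
  have hpar : ∀ w, w ∉ K → bag C w.succ = bag C (spiderParent l w) := fun w hw =>
    bag_eq_of_mem (not_not.1 (mt (hK w).2 hw))
  have hadj : ∀ w ∈ K, (contractEdges (spider n l) C).Adj (bag C (spiderParent l w))
      (bag C w.succ) := fun w hw =>
    ((contractEdges_adj_iff hT hC).2 ⟨_, _, spider_adj_parent hl w, (hK w).1 hw, rfl, rfl⟩).symm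
  set F := {w ∈ K | w.val % l = j} with hF
  have hne : F.Nonempty := Finset.card_pos.1 (by omega)
  set w₁ := F.min' hne with hw₁
  have hm₁ : w₁ ∈ F := F.min'_mem hne
  have hne' : (F.erase w₁).Nonempty :=
    Finset.card_pos.1 (by rw [Finset.card_erase_of_mem hm₁]; omega)
  set w₂ := (F.erase w₁).min' hne' with hw₂
  have hm₂ : w₂ ∈ F.erase w₁ := (F.erase w₁).min'_mem hne'
  have hmin₁ : ∀ w ∈ F, w₁ ≤ w := fun w hw => F.min'_le w hw
  have hmin₂ : ∀ w ∈ F, w ≠ w₁ → w₂ ≤ w := fun w hw h =>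
    (F.erase w₁).min'_le w (Finset.mem_erase.2 ⟨h, hw⟩)
  rw [Finset.mem_erase] at hm₂
  have hlt : w₁ < w₂ := lt_of_le_of_ne (hmin₁ _ hm₂.2) (Ne.symm hm₂.1)
  have hj₁ := (Finset.mem_filter.1 hm₁).2
  have hj₂ := (Finset.mem_filter.1 hm₂.2).2
  have hK₁ := (Finset.mem_filter.1 hm₁).1
  have hK₂ := (Finset.mem_filter.1 hm₂.2).1
  -- Descending from a vertex towards the centre, no kept edge is met before `w₁` or `w₂`.
  have hbag₀ : ∀ k (hk : k < n + 1), (∀ w ∈ K, w.val % l = (k - 1) % l → k ≤ w.val) →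
      bag C ⟨k, hk⟩ = bag C 0 := by
    intro k
    induction k using Nat.strong_induction_on with | _ k ih =>
    intro hk h
    rcases Nat.eq_zero_or_pos k with rfl | hk0
    · rfl
    have h1 : (⟨k - 1, by omega⟩ : Fin n) ∉ K := fun h' => by
      have := h _ h' rfl
      simp only at this
      omega
    have h2 := hpar _ h1
    have h3 : spiderParent l (⟨k - 1, by omega⟩ : Fin n) = (⟨k - l, by omega⟩ : Fin (n + 1)) :=
      Fin.ext (by simp only [spiderParent]; omega)
    have h4 : (⟨k - 1, by omega⟩ : Fin n).succ = ⟨k, hk⟩ := Fin.ext (by simp; omega)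
    rw [h3, h4] at h2
    rw [h2]
    rcases le_or_gt k l with hkl | hkl
    · congr 1
      exact Fin.ext (by simp; omega)
    · refine ih (k - l) (by omega) (by omega) fun w hw hwl => ?_
      have h5 : (k - l - 1) % l = (k - 1) % l := by
        rw [Nat.sub_right_comm, ← Nat.mod_eq_sub_mod (by omega)]
      have := h w hw (hwl.trans h5)
      omega
  have hbag₁ : ∀ k (hk : k < n + 1), w₁.val < k → (k - 1) % l = j →
      (∀ w ∈ F, w ≠ w₁ → k ≤ w.val) → bag C ⟨k, hk⟩ = bag C w₁.succ := by
    intro k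
    induction k using Nat.strong_induction_on with | _ k ih =>
    intro hk hk₁ hkj h
    by_cases hkw : k = w₁.val + 1
    · congr 1
      exact Fin.ext (by simpa using hkw)
    have h1 : (⟨k - 1, by omega⟩ : Fin n) ∉ K := fun h' => by
      have := h ⟨k - 1, by omega⟩ (Finset.mem_filter.2 ⟨h', hkj⟩)
        (fun h => hkw (by have := congrArg Fin.val h; simp only at this; omega))
      simp only at this
      omega
    have h2 := hpar _ h1
    have h3 : spiderParent l (⟨k - 1, by omega⟩ : Fin n) = (⟨k - l, by omega⟩ : Fin (n + 1)) :=
      Fin.ext (by simp only [spiderParent]; omega)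
    have h4 : (⟨k - 1, by omega⟩ : Fin n).succ = ⟨k, hk⟩ := Fin.ext (by simp; omega)
    rw [h3, h4] at h2
    rw [h2]
    have h6 : l ∣ k - 1 - w₁.val := (Nat.modEq_iff_dvd' (by omega)).1 (hj₁.trans hkj.symm)
    have h7 := Nat.le_of_dvd (by omega) h6
    refine ih (k - l) (by omega) (by omega) (by omega) ?_ fun w hw hwl => ?_
    · rw [← hkj, Nat.sub_right_comm, ← Nat.mod_eq_sub_mod (by omega)]
    · have := h w hw hwl
      omega
  have hpos₁ : legPosition l K w₁.succ = (j, 1) := by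
    have : {w ∈ K | w.val % l = (w₁.succ.val - 1) % l ∧ w.val < w₁.succ.val} = {w₁} := by
      ext w
      simp only [Finset.mem_filter, Finset.mem_singleton, Fin.val_succ, Nat.add_sub_cancel, hj₁]
      constructor
      · rintro ⟨h1, h2, h3⟩
        have := hmin₁ w (Finset.mem_filter.2 ⟨h1, h2⟩)
        exact le_antisymm (Fin.le_def.2 (by omega)) this
      · rintro rfl
        exact ⟨hK₁, hj₁, by omega⟩
    simp only [legPosition, this, Finset.card_singleton]
    simp [hj₁]
  have hpos₂ : legPosition l K w₂.succ = (j, 2) := by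
    have : {w ∈ K | w.val % l = (w₂.succ.val - 1) % l ∧ w.val < w₂.succ.val} = {w₁, w₂} := by
      ext w
      simp only [Finset.mem_filter, Finset.mem_insert, Finset.mem_singleton, Fin.val_succ,
        Nat.add_sub_cancel, hj₂]
      constructor
      · rintro ⟨h1, h2, h3⟩
        by_cases h : w = w₁
        · exact .inl h
        · have := hmin₂ w (Finset.mem_filter.2 ⟨h1, h2⟩) h
          exact .inr (le_antisymm (Fin.le_def.2 (by omega)) this)
      · rintro (h | h)
        · rw [h]
          exact ⟨hK₁, hj₁, by have := Fin.lt_def.1 hlt; omega⟩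
        · rw [h]
          exact ⟨hK₂, hj₂, by omega⟩
    simp only [legPosition, this, Finset.card_pair hlt.ne]
    simp [hj₂]
  refine ⟨w₁.succ, w₂.succ, hpos₁, hpos₂, ?_, ?_⟩
  · have h1 := hadj w₁ hK₁
    convert h1 using 1
    refine (hbag₀ _ _ fun w hw hwl => ?_).symm
    rcases le_or_gt (w₁.val + 1) l with h | h
    · omega
    · have h5 : (w₁.val + 1 - l - 1) % l = j := by
        rw [Nat.sub_right_comm, Nat.add_sub_cancel, ← Nat.mod_eq_sub_mod (by omega), hj₁]
      have := Fin.le_def.1 (hmin₁ w (Finset.mem_filter.2 ⟨hw, hwl.trans h5⟩))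
      omega
  · have h1 := hadj w₂ hK₂
    convert h1 using 1
    have hlt' := Fin.lt_def.1 hlt
    have h6 : l ∣ w₂.val - w₁.val := (Nat.modEq_iff_dvd' (by omega)).1 (hj₁.trans hj₂.symm)
    have h7 := Nat.le_of_dvd (by omega) h6
    refine (hbag₁ _ _ (by omega) ?_ fun w hw hne => ?_).symm
    · rw [Nat.sub_right_comm, Nat.add_sub_cancel, ← Nat.mod_eq_sub_mod (by omega), hj₂]
    · have := Fin.le_def.1 (hmin₂ w hw hne)
      omega

/-- In a caterpillar no three neighbours of a vertex have another neighbour: being non-leaf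
vertices, they and the vertex would be part of a path. -/
lemma IsCaterpillar.not_three_neighbors {W : Type} {G : SimpleGraph W} (hG : IsCaterpillar G)
    {x : W} {y z : Fin 3 → W} (hxy : ∀ i, G.Adj x (y i)) (hyz : ∀ i, G.Adj (y i) (z i))
    (hne : ∀ i, x ≠ z i) (hinj : Function.Injective y) : False := by
  obtain ⟨-, m, ⟨φ⟩⟩ := hG
  have hy : ∀ i, ¬ IsLeafVertex G (y i) := fun i h => hne i (h.unique (hxy i).symm (hyz i))
  have hx : ¬ IsLeafVertex G x := fun h => by
    have := hinj (h.unique (hxy 0) (hxy 1))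
    simp at this
  have hval : ∀ i, (φ ⟨x, hx⟩).val + 1 = (φ ⟨y i, hy i⟩).val ∨
      (φ ⟨y i, hy i⟩).val + 1 = (φ ⟨x, hx⟩).val := fun i => by
    rw [← SimpleGraph.pathGraph_adj, φ.map_adj_iff]
    exact hxy i
  have hd : ∀ i j, i ≠ j → (φ ⟨y i, hy i⟩).val ≠ (φ ⟨y j, hy j⟩).val := fun i j hij h =>
    hij (hinj (congrArg Subtype.val (φ.injective (Fin.ext h))))
  have h0 := hval 0
  have h1 := hval 1
  have h2 := hval 2
  have h3 := hd 0 1 (by decide)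
  have h4 := hd 0 2 (by decide)
  have h5 := hd 1 2 (by decide)
  omega

lemma spider_caterpillar_le {r k : ℕ} (hl : 1 ≤ l) (hr : 1 ≤ r) (hn : n ≤ l * r)
    (h : ContractsToCaterpillar (spider n l) k) : k + 2 ≤ 2 * r + l := by
  classical
  obtain ⟨C, hC, hcat, hk⟩ := h
  let K : Finset (Fin n) := {w | spiderEdge l w ∉ C}
  have hK : ∀ w, w ∈ K ↔ spiderEdge l w ∉ C := fun w => by simp [K]
  have hkK : k = K.card := by
    rw [← hk, contractEdges_ncard_edgeSet (spider_isTree hl) hC, spider_edgeSet hl,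
      ← Finset.card_image_of_injective _ (spiderEdge_injective hl), ← Set.ncard_coe_finset]
    congr 1
    ext e
    simp only [Set.mem_sdiff, Set.mem_range, Finset.coe_image, Set.mem_image, Finset.mem_coe, hK]
    constructor
    · rintro ⟨⟨w, rfl⟩, h⟩
      exact ⟨w, h, rfl⟩
    · rintro ⟨w, h, rfl⟩
      exact ⟨⟨w, rfl⟩, h⟩
  have hfib : ∀ j, {v ∈ K.map Fin.valEmbedding | v % l = j}.card = {w ∈ K | w.val % l = j}.card :=
    fun j => by rw [Finset.filter_map, Finset.card_map]; rfl
  rw [hkK, ← Finset.card_map Fin.valEmbedding]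
  refine card_add_two_le_of_legs (B := {j ∈ Finset.range l | 2 ≤ {w ∈ K | w.val % l = j}.card})
    hr ?_ ?_ ?_ hl
  · intro v hv
    obtain ⟨w, -, rfl⟩ := Finset.mem_map.1 hv
    exact w.2.trans_le hn
  · by_contra! h3
    obtain ⟨i₀, i₁, i₂, h0, h1, h2, h01, h02, h12⟩ := Finset.two_lt_card_iff.1 h3
    let i : Fin 3 → ℕ := ![i₀, i₁, i₂]
    have hi : Function.Injective i := by
      intro a b
      fin_cases a <;> fin_cases b <;> simp [i, h01, h02, h12, h01.symm, h02.symm, h12.symm]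
    have h2i : ∀ t, 2 ≤ {w ∈ K | w.val % l = i t}.card := by
      intro t
      fin_cases t
      · exact (Finset.mem_filter.1 h0).2
      · exact (Finset.mem_filter.1 h1).2
      · exact (Finset.mem_filter.1 h2).2
    choose v u hv hu hadj hadj' using fun t => exists_neighbor_of_leg hl hC hK (h2i t)
    have hpos : ∀ {p q}, bag C p = bag C q → legPosition l K p = legPosition l K q := by
      intro p q hpq
      refine eq_of_bag_eq (fun p q hpq => ?_) hpq
      obtain ⟨w, hw⟩ := (spider_edgeSet hl).subset (hC hpq)
      have hwK : w ∉ K := by rw [hK, hw, not_not]; exact hpq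
      rcases Sym2.eq_iff.1 hw with ⟨rfl, rfl⟩ | ⟨rfl, rfl⟩
      · exact legPosition_parent hl hwK
      · exact (legPosition_parent hl hwK).symm
    refine hcat.not_three_neighbors hadj hadj' (fun t h => ?_) fun s t h => ?_
    · have := hpos h
      rw [hu] at this
      simp [legPosition] at this
    · have := hpos h
      rw [hv, hv] at this
      exact hi (congrArg Prod.fst this)
  · intro j hj
    rw [hfib]
    by_contra! h
    refine hj (Finset.mem_filter.2 ⟨?_, h⟩)
    obtain ⟨w, hw⟩ := Finset.card_pos.1 (by omega : 0 < {w ∈ K | w.val % l = j}.card)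
    rw [← (Finset.mem_filter.1 hw).2, Finset.mem_range]
    exact Nat.mod_lt _ hl

end Spider

/-! ### Orientation of triples of points in the plane -/

/-- Twice the signed area of the triangle `p q r`. -/
def orient (p q r : Plane) : ℝ := (q 0 - p 0) * (r 1 - p 1) - (q 1 - p 1) * (r 0 - p 0)

lemma orient_rotate (p q r : Plane) : orient q r p = orient p q r := by
  simp only [orient]; ring

lemma orient_swap (p q r : Plane) : orient p r q = -orient p q r := by
  simp only [orient]; ring

lemma orient_flip (p q r : Plane) : orient p q r = -orient q p r := by
  simp only [orient]; ring

lemma orient_self_left (p q : Plane) : orient p p q = 0 := by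
  simp only [orient]; ring

lemma orient_self_right (p q : Plane) : orient p q q = 0 := by
  simp only [orient]; ring

lemma orient_left_right (p q : Plane) : orient p q p = 0 := by
  simp only [orient]; ring

lemma orient_combo (p q x y : Plane) {s t : ℝ} (h : s + t = 1) :
    orient p q (s • x + t • y) = s * orient p q x + t * orient p q y := by
  obtain rfl : s = 1 - t := by linarith
  simp only [orient, PiLp.add_apply, PiLp.smul_apply, smul_eq_mul]
  ring

lemma orient_eq_zero_of_mem_segment {p q x : Plane} (h : x ∈ segment ℝ p q) : orient p q x = 0 := by
  obtain ⟨s, t, -, -, hst, rfl⟩ := h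
  rw [orient_combo p q p q hst, orient_left_right, orient_self_right]
  ring

/-- A segment on one side of a line is disjoint from segments on that line. -/
lemma disjoint_segment_of_orient {p q x y : Plane} (ε : ℝ) (hx : 0 < ε * orient p q x)
    (hy : 0 < ε * orient p q y) : Disjoint (segment ℝ p q) (segment ℝ x y) := by
  rw [Set.disjoint_left]
  rintro z hz ⟨s, t, hs, ht, hst, rfl⟩
  have h := orient_eq_zero_of_mem_segment hz
  rw [orient_combo p q x y hst] at h
  have h' : s * (ε * orient p q x) + t * (ε * orient p q y) = 0 := by linear_combination ε * h
  rcases hs.eq_or_lt with rfl | hs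
  · obtain rfl : t = 1 := by linarith
    linarith
  · have := mul_pos hs hx
    have := mul_nonneg ht hy.le
    linarith

lemma segment_inter_of_orient {p q r : Plane} (h : orient p q r ≠ 0) :
    segment ℝ p q ∩ segment ℝ q r = {q} := by
  ext z
  simp only [Set.mem_inter_iff, Set.mem_singleton_iff]
  constructor
  · rintro ⟨hz, s, t, -, -, hst, rfl⟩
    have h0 := orient_eq_zero_of_mem_segment hz
    rw [orient_combo p q q r hst, orient_self_right, mul_zero, zero_add] at h0
    obtain rfl : t = 0 := (mul_eq_zero.1 h0).resolve_right h
    obtain rfl : s = 1 := by linarith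
    simp
  · rintro rfl
    exact ⟨right_mem_segment ℝ _ _, left_mem_segment ℝ _ _⟩

/-- The diagonals of a convex quadrilateral meet. -/
lemma not_disjoint_diagonals {p q r s : Plane} (hpqr : 0 < orient p q r) (hprs : 0 < orient p r s)
    (hpqs : 0 < orient p q s) (hqrs : 0 < orient q r s) :
    ¬ Disjoint (segment ℝ p r) (segment ℝ q s) := by
  have hsum : orient q r s + orient p q s = orient p r s + orient p q r := by
    simp only [orient]; ring
  have hpos : 0 < orient p r s + orient p q r := by linarith
  rw [Set.not_disjoint_iff]
  refine ⟨(orient p r s / (orient p r s + orient p q r)) • q +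
    (orient p q r / (orient p r s + orient p q r)) • s, ?_, ?_⟩
  · refine ⟨orient q r s / (orient p r s + orient p q r),
      orient p q s / (orient p r s + orient p q r), by positivity, by positivity, ?_, ?_⟩
    · rw [← add_div, hsum, div_self hpos.ne']
    · ext i
      simp only [PiLp.add_apply, PiLp.smul_apply, smul_eq_mul]
      field_simp
      fin_cases i <;> simp only [orient, Fin.zero_eta, Fin.mk_one] <;> ring
  · refine ⟨_, _, by positivity, by positivity, ?_, rfl⟩
    rw [← add_div, div_self hpos.ne']

/-- A polygonal chain is simple if, for each of its segments, all later vertices are strictly on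
one side of the line through that segment. -/
lemma isSimpleChain_of_orient {v : ℕ → Plane} {m : ℕ} (hne : ∀ i, i < m → v i ≠ v (i + 1))
    (h : ∀ i, i < m → ∃ ε : ℝ, ∀ j, i + 1 < j → j ≤ m → 0 < ε * orient (v i) (v (i + 1)) (v j)) :
    IsSimpleChain v m := by
  refine ⟨hne, fun i hi => ?_, fun i j hij hj => ?_⟩
  · obtain ⟨ε, hε⟩ := h i (by omega)
    exact segment_inter_of_orient (right_ne_zero_of_mul (hε (i + 2) (by omega) (by omega)).ne')
  · obtain ⟨ε, hε⟩ := h i (by omega)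
    exact disjoint_segment_of_orient ε (hε j hij hj.le) (hε (j + 1) (by omega) hj)

/-! ### Cyclic order of points in convex position -/

section CyclicOrder

variable {ι : Type} {P : ι → Plane}

lemma ConvexIndependent.false_of_combination (hP : ConvexIndependent ℝ P) {x y z w : ι} {α β γ : ℝ}
    (hxy : x ≠ y) (hxz : x ≠ z) (hxw : x ≠ w) (hα : 0 ≤ α) (hβ : 0 ≤ β) (hγ : 0 ≤ γ)
    (hpos : 0 < α + β + γ)
    (h0 : (α + β + γ) * P x 0 = α * P y 0 + β * P z 0 + γ * P w 0)
    (h1 : (α + β + γ) * P x 1 = α * P y 1 + β * P z 1 + γ * P w 1) : False := by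
  have hmem : P x ∈ convexHull ℝ (P '' {y, z, w}) := by
    have hsub := subset_convexHull ℝ (P '' {y, z, w})
    have key := (convex_convexHull ℝ (P '' {y, z, w})).sum_mem (t := Finset.univ)
      (w := ![α / (α + β + γ), β / (α + β + γ), γ / (α + β + γ)]) (z := ![P y, P z, P w])
      (by
        intro i _
        fin_cases i
        · exact div_nonneg hα hpos.le
        · exact div_nonneg hβ hpos.le
        · exact div_nonneg hγ hpos.le)
      (by
        rw [Fin.sum_univ_three]
        simp only [Matrix.cons_val]
        rw [← add_div, ← add_div, div_self hpos.ne'])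
      (by
        intro i _
        fin_cases i
        · exact hsub ⟨y, by simp, rfl⟩
        · exact hsub ⟨z, by simp, rfl⟩
        · exact hsub ⟨w, by simp, rfl⟩)
    convert key using 1
    rw [Fin.sum_univ_three]
    ext i
    simp only [Matrix.cons_val, PiLp.add_apply, PiLp.smul_apply, smul_eq_mul]
    rw [div_mul_eq_mul_div, div_mul_eq_mul_div, div_mul_eq_mul_div, ← add_div, ← add_div,
      eq_div_iff hpos.ne', mul_comm]
    fin_cases i
    · exact h0
    · exact h1
  have := hP _ _ hmem
  simp only [Set.mem_insert_iff, Set.mem_singleton_iff] at this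
  tauto

lemma ConvexIndependent.orient_ne_zero (hP : ConvexIndependent ℝ P) {x y z : ι} (hxy : x ≠ y)
    (hxz : x ≠ z) (hyz : y ≠ z) : orient (P x) (P y) (P z) ≠ 0 := by
  intro h
  have key : ∀ {i j}, i ≠ j → 0 < (P i 0 - P j 0) ^ 2 + (P i 1 - P j 1) ^ 2 := by
    intro i j hij
    by_contra! hle
    refine hij (hP.injective ?_)
    ext t
    fin_cases t
    · simp only [Fin.zero_eta]; nlinarith [sq_nonneg (P i 0 - P j 0), sq_nonneg (P i 1 - P j 1)]
    · simp only [Fin.mk_one]; nlinarith [sq_nonneg (P i 0 - P j 0), sq_nonneg (P i 1 - P j 1)]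
  have hA := key hxy.symm
  have hD := key hxz.symm
  simp only [orient] at h
  -- One of the three collinear points lies between the others; inner products tell which.
  set B := (P y 0 - P x 0) * (P z 0 - P x 0) + (P y 1 - P x 1) * (P z 1 - P x 1) with hB
  set A := (P y 0 - P x 0) ^ 2 + (P y 1 - P x 1) ^ 2 with hA'
  set D := (P z 0 - P x 0) ^ 2 + (P z 1 - P x 1) ^ 2 with hD'
  rcases le_or_gt B 0 with hB0 | hB0
  · refine hP.false_of_combination (x := x) (y := y) (z := z) (w := z) (α := D) (β := -B) (γ := 0)
      hxy hxz hxz hD.le (by linarith) le_rfl (by linarith) ?_ ?_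
    · rw [hD', hB]; linear_combination -(P z 1 - P x 1) * h
    · rw [hD', hB]; linear_combination (P z 0 - P x 0) * h
  rcases le_or_gt B A with hBA | hBA
  · refine hP.false_of_combination (x := z) (y := x) (z := y) (w := y) (α := A - B) (β := B)
      (γ := 0) hxz.symm hyz.symm hyz.symm (by linarith) hB0.le le_rfl (by linarith) ?_ ?_
    · rw [hA', hB]; linear_combination -(P y 1 - P x 1) * h
    · rw [hA', hB]; linear_combination (P y 0 - P x 0) * h
  · refine hP.false_of_combination (x := y) (y := x) (z := z) (w := z) (α := B - A) (β := A)
      (γ := 0) hxy.symm hyz hyz (by linarith) hA.le le_rfl (by linarith) ?_ ?_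
    · rw [hA', hB]; linear_combination (P y 1 - P x 1) * h
    · rw [hA', hB]; linear_combination -(P y 0 - P x 0) * h

lemma ne_of_orient_pos {p q r : Plane} (h : 0 < orient p q r) : p ≠ q ∧ p ≠ r ∧ q ≠ r := by
  refine ⟨?_, ?_, ?_⟩ <;> rintro rfl
  · rw [orient_self_left] at h; exact h.false
  · rw [orient_left_right] at h; exact h.false
  · rw [orient_self_right] at h; exact h.false

lemma ConvexIndependent.orient_trans (hP : ConvexIndependent ℝ P) {x i j k : ι}
    (hij : 0 < orient (P x) (P i) (P j)) (hjk : 0 < orient (P x) (P j) (P k)) :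
    0 < orient (P x) (P i) (P k) := by
  by_contra! h
  have h1 := ne_of_orient_pos hij
  have h2 := ne_of_orient_pos hjk
  refine hP.false_of_combination (x := x) (y := i) (z := j) (w := k)
    (α := orient (P x) (P j) (P k)) (β := -orient (P x) (P i) (P k))
    (γ := orient (P x) (P i) (P j)) (fun h => h1.1 (h ▸ rfl)) (fun h => h2.1 (h ▸ rfl))
    (fun h => h2.2.1 (h ▸ rfl)) hjk.le (by linarith) hij.le (by linarith) ?_ ?_ <;>
  simp only [orient] <;> ring

lemma ConvexIndependent.orient_of_orient (hP : ConvexIndependent ℝ P) {x i j k : ι}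
    (hij : 0 < orient (P x) (P i) (P j)) (hjk : 0 < orient (P x) (P j) (P k)) :
    0 < orient (P i) (P j) (P k) := by
  by_contra! h
  have h1 := ne_of_orient_pos hij
  have h2 := ne_of_orient_pos hjk
  refine hP.false_of_combination (x := j) (y := x) (z := i) (w := k)
    (α := -orient (P i) (P j) (P k)) (β := orient (P x) (P j) (P k))
    (γ := orient (P x) (P i) (P j)) (fun h => h2.1 (h ▸ rfl)) (fun h => h1.2.2 (h ▸ rfl))
    (fun h => h2.2.2 (h ▸ rfl)) (by linarith) hjk.le hij.le (by linarith) ?_ ?_ <;>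
  simp only [orient] <;> ring

/-- `q` runs with period `N` through the points of `P`, counterclockwise around their convex
hull. -/
structure IsCyclicOrder (P : ι → Plane) (N : ℕ) (q : ℕ → ι) : Prop where
  periodic : ∀ i, q (i + N) = q i
  surj : ∀ y, ∃ i < N, q i = y
  inj : ∀ i j, i < N → j < N → q i = q j → i = j
  orient_pos : ∀ i j k, i < j → j < k → k < N → 0 < orient (P (q i)) (P (q j)) (P (q k))

lemma IsCyclicOrder.shift_one {N : ℕ} {q : ℕ → ι} (h : IsCyclicOrder P N q) :
    IsCyclicOrder P N fun i => q (i + 1) := by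
  have h0 : ∀ i, i + 1 = N → q (i + 1) = q 0 := fun i hi => by
    rw [hi, ← h.periodic 0, zero_add]
  refine ⟨fun i => ?_, fun y => ?_, fun i j hi hj hij => ?_, fun i j k hij hjk hk => ?_⟩
  · rw [Nat.add_right_comm, h.periodic]
  · obtain ⟨i, hi, rfl⟩ := h.surj y
    rcases Nat.eq_zero_or_pos i with rfl | hi0
    · exact ⟨N - 1, by omega, h0 _ (by omega)⟩
    · exact ⟨i - 1, by omega, by rw [Nat.sub_add_cancel hi0]⟩
  · rcases Nat.lt_or_ge (i + 1) N with hi' | hi' <;> rcases Nat.lt_or_ge (j + 1) N with hj' | hj'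
    · have := h.inj _ _ hi' hj' hij
      omega
    · rw [h0 j (by omega)] at hij
      have := h.inj _ _ hi' (by omega) hij
      omega
    · rw [h0 i (by omega)] at hij
      have := h.inj _ _ (by omega) hj' hij
      omega
    · omega
  · rcases Nat.lt_or_ge (k + 1) N with hk' | hk'
    · exact h.orient_pos _ _ _ (by omega) (by omega) hk'
    · rw [h0 k (by omega), orient_rotate]
      exact h.orient_pos _ _ _ (by omega) (by omega) (by omega)

lemma IsCyclicOrder.shift {N : ℕ} {q : ℕ → ι} (h : IsCyclicOrder P N q) (x : ℕ) :
    IsCyclicOrder P N fun i => q (i + x) := by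
  induction x with
  | zero => exact h
  | succ x ih => simpa only [add_right_comm, add_assoc] using ih.shift_one

/-- Points in convex position can be listed counterclockwise: around one of them, the orientation
of triples is a linear order of the others. -/
lemma ConvexIndependent.exists_isCyclicOrder [Fintype ι] (hP : ConvexIndependent ℝ P) (x : ι) :
    ∃ q, IsCyclicOrder P (Fintype.card ι) q := by
  classical
  let r : ι → ι → Prop := fun i j => j ≠ x ∧ (i = x ∨ 0 < orient (P x) (P i) (P j))
  have hirr : ∀ i, ¬ r i i := by
    rintro i ⟨h, h' | h'⟩
    · exact h h'
    · rw [orient_self_right] at h'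
      exact h'.false
  have htrans : ∀ i j k, r i j → r j k → r i k := by
    rintro i j k ⟨hj, hij⟩ ⟨hk, hjk⟩
    refine ⟨hk, hij.imp_right fun h => hP.orient_trans h (hjk.resolve_left hj)⟩
  have htri : ∀ i j, ¬ r i j → ¬ r j i → i = j := by
    intro i j h h'
    by_contra hij
    by_cases hi : i = x
    · exact h ⟨fun hj => hij (hi.trans hj.symm), .inl hi⟩
    by_cases hj : j = x
    · exact h' ⟨hi, .inl hj⟩
    rcases lt_or_gt_of_ne (hP.orient_ne_zero (Ne.symm hi) (Ne.symm hj) hij) with h1 | h1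
    · exact h' ⟨hi, .inr (by rw [orient_swap]; linarith)⟩
    · exact h ⟨hj, .inr h1⟩
  have : Std.Irrefl r := ⟨hirr⟩
  have : IsTrans ι r := ⟨htrans⟩
  have : Std.Trichotomous r := ⟨htri⟩
  have : IsStrictTotalOrder ι r := {}
  let _ : LinearOrder ι := linearOrderOfSTO r
  let e : Fin (Fintype.card ι) ≃o ι := Fintype.orderIsoFinOfCardEq ι rfl
  have hN : 0 < Fintype.card ι := Fintype.card_pos_iff.2 ⟨x⟩
  have hr : ∀ {i j : ι}, i < j → r i j := fun h => h
  refine ⟨fun i => e ⟨i % Fintype.card ι, Nat.mod_lt _ hN⟩, fun i => ?_, fun y => ?_,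
    fun i j hi hj hij => ?_, fun i j k hij hjk hk => ?_⟩
  · simp only [Nat.add_mod_right]
  · refine ⟨(e.symm y).val, (e.symm y).2, ?_⟩
    simp only [Nat.mod_eq_of_lt (e.symm y).2, Fin.eta, OrderIso.apply_symm_apply]
  · have := congrArg Fin.val (e.injective hij)
    simpa only [Nat.mod_eq_of_lt hi, Nat.mod_eq_of_lt hj] using this
  · simp only [Nat.mod_eq_of_lt hk, Nat.mod_eq_of_lt (hjk.trans hk),
      Nat.mod_eq_of_lt (hij.trans (hjk.trans hk))]
    have h1 := hr (e.lt_iff_lt.2 (Fin.mk_lt_mk.2 hij : (⟨i, by omega⟩ : Fin _) < ⟨j, by omega⟩))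
    have h2 := hr (e.lt_iff_lt.2 (Fin.mk_lt_mk.2 hjk : (⟨j, by omega⟩ : Fin _) < ⟨k, hk⟩))
    have h3 := h2.2.resolve_left h1.1
    rcases h1.2 with h4 | h4
    · rw [h4]
      exact h3
    · exact hP.orient_of_orient h4 h3

end CyclicOrder

/-! ### Noncrossing matchings -/

/-- `π` matches the numbers below `N` in pairs, and no two pairs interleave. -/
structure IsNoncrossingMatching (N : ℕ) (π : ℕ → ℕ) : Prop where
  lt : ∀ i, i < N → π i < N
  invol : ∀ i, i < N → π (π i) = i
  ne : ∀ i, i < N → π i ≠ i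
  noncrossing : ∀ i j, j < N → i < j → j < π i → π i < π j → False

section Matching

variable {N D : ℕ} {π : ℕ → ℕ}

lemma IsNoncrossingMatching.inj (h : IsNoncrossingMatching N π) {i j : ℕ} (hi : i < N) (hj : j < N)
    (hij : π i = π j) : i = j := by
  rw [← h.invol i hi, hij, h.invol j hj]

/-- Between the two elements of a pair, or at them, there is a pair of neighbours. -/
lemma IsNoncrossingMatching.exists_adjacent (h : IsNoncrossingMatching N π) (i : ℕ) (hi : i < N)
    (hlt : i < π i) : ∃ c, i ≤ c ∧ c < π i ∧ π c = c + 1 := by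
  induction hd : π i - i using Nat.strong_induction_on generalizing i with | _ d ih =>
  by_cases h1 : π i = i + 1
  · exact ⟨i, le_rfl, hlt, h1⟩
  have hπi := h.lt i hi
  have hi' : i + 1 < N := by omega
  have hne := h.ne (i + 1) hi'
  have hinv := h.invol (i + 1) hi'
  have hlow : ¬ π (i + 1) < i := fun h' => by
    refine h.noncrossing (π (i + 1)) i hi h' ?_ ?_ <;> rw [hinv] <;> omega
  have hself : π (i + 1) ≠ i := fun h' => by rw [h'] at hinv; omega
  have hself' : π (i + 1) ≠ π i := fun h' => by
    have := h.inj hi' hi h'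
    omega
  have hhigh : ¬ π i < π (i + 1) := h.noncrossing i (i + 1) hi' (by omega) (by omega)
  obtain ⟨c, hc, hc', hcc⟩ := ih (π (i + 1) - (i + 1)) (by omega) (i + 1) hi' (by omega) rfl
  exact ⟨c, by omega, by omega, hcc⟩

/-- The pairs that an alternating path is to use, given by their larger elements. `A` tells the
positions of neighbours, in a cyclic sense, that make up a pair. If `D` is smallest such that they
occur among any `D` consecutive positions, and the `D - 1` first positions do not contain any, then
the pairs of the numbers below `D` can be used, together with the pairs of neighbours above. -/
lemma IsNoncrossingMatching.exists_large_family (h : IsNoncrossingMatching N π) (hN : 0 < N)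
    {A : ℕ → Prop} (hper : ∀ i, A (i + N) ↔ A i) (hA : ∀ i, i + 1 < N → (A i ↔ π i = i + 1))
    (hD : ∀ x, ∃ j < D, A (x + j)) (hrun : ∀ j, j + 1 < D → ¬ A j) :
    ∃ (l : ℕ) (Y : Finset ℕ), N ≤ D * (l + 2) ∧ D + l ≤ Y.card ∧
      ∀ y ∈ Y, D ≤ y ∧ y < N ∧ (π y < D ∨ D ≤ π y ∧ π y + 1 = y) := by
  classical
  have hmod : ∀ i, A (i % N) ↔ A i := fun i => by
    induction i using Nat.strong_induction_on with | _ i ih =>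
    rcases Nat.lt_or_ge i N with hi | hi
    · rw [Nat.mod_eq_of_lt hi]
    · rw [Nat.mod_eq_sub_mod hi, ih (i - N) (by omega), ← hper, Nat.sub_add_cancel hi]
  have hD0 : 0 < D := by
    obtain ⟨j, hj, -⟩ := hD 0
    omega
  have hout : ∀ c, c < D → c < N → D ≤ π c := by
    intro c hcD hcN
    by_contra! hlt
    have hπ := h.lt c hcN
    rcases lt_or_gt_of_ne (h.ne c hcN) with h1 | h1
    · obtain ⟨i, hi, hi', hii⟩ := h.exists_adjacent (π c) hπ (by rwa [h.invol c hcN])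
      rw [h.invol c hcN] at hi'
      exact hrun i (by omega) ((hA i (by omega)).2 hii)
    · obtain ⟨i, hi, hi', hii⟩ := h.exists_adjacent c hcN h1
      exact hrun i (by omega) ((hA i (by omega)).2 hii)
  have hDN : D < N := (hout 0 hD0 hN).trans_lt (h.lt 0 hN)
  let L : Finset ℕ := {i ∈ Finset.range N | D ≤ i ∧ i + 1 < N ∧ A i}
  have hL : ∀ i, i ∈ L ↔ D ≤ i ∧ i + 1 < N ∧ A i := fun i => by
    simp only [L, Finset.mem_filter, Finset.mem_range]
    constructor
    · exact fun h => h.2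
    · exact fun h => ⟨by omega, h⟩
  refine ⟨L.card, (Finset.range D).image π ∪ L.image (· + 1), ?_, ?_, ?_⟩
  · -- A pair of neighbours other than those in `L` involves the position `D - 1` or `N - 1`.
    choose f hf hf' using hD
    have hmaps : ∀ x ∈ Finset.range N,
        ((x + f x) % N, f x) ∈ (insert (D - 1) (insert (N - 1) L)) ×ˢ Finset.range D := by
      intro x _
      rw [Finset.mem_product]
      refine ⟨?_, Finset.mem_range.2 (hf x)⟩
      have h1 := (hmod _).2 (hf' x)
      have h2 := Nat.mod_lt (x + f x) hN
      simp only [Finset.mem_insert, hL]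
      by_contra! h3
      by_cases h4 : (x + f x) % N + 1 < D
      · exact hrun _ h4 h1
      · exact h3.2.2 (by omega) (by omega) h1
    have hinj : Set.InjOn (fun x => ((x + f x) % N, f x)) (Finset.range N) := by
      intro x hx y hy hxy
      rw [Finset.mem_coe, Finset.mem_range] at hx hy
      have h1 : f x = f y := congrArg Prod.snd hxy
      have h2 : (x + f x) % N = (y + f y) % N := congrArg Prod.fst hxy
      rw [h1] at h2
      have h3 : x ≡ y [MOD N] := Nat.ModEq.add_right_cancel' _ h2
      exact Nat.ModEq.eq_of_lt_of_lt h3 hx hy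
    have h1 := Finset.card_le_card_of_injOn _ hmaps hinj
    rw [Finset.card_range, Finset.card_product, Finset.card_range] at h1
    have h2 := Finset.card_insert_le (D - 1) (insert (N - 1) L)
    have h3 := Finset.card_insert_le (N - 1) L
    calc N ≤ _ := h1
      _ ≤ (L.card + 2) * D := Nat.mul_le_mul_right _ (by omega)
      _ = D * (L.card + 2) := Nat.mul_comm _ _
  · rw [Finset.card_union_of_disjoint, Finset.card_image_of_injOn, Finset.card_range,
      Finset.card_image_of_injective _ (add_left_injective 1)]
    · intro c hc c' hc' hcc
      rw [Finset.mem_coe, Finset.mem_range] at hc hc'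
      exact h.inj (by omega) (by omega) hcc
    · rw [Finset.disjoint_left]
      intro y hy hy'
      obtain ⟨c, hc, rfl⟩ := Finset.mem_image.1 hy
      obtain ⟨i, hi, hic⟩ := Finset.mem_image.1 hy'
      rw [Finset.mem_range] at hc
      rw [hL] at hi
      have h1 := (hA i hi.2.1).1 hi.2.2
      rw [hic] at h1
      have := h.inj (by omega) (by omega) h1
      omega
  · intro y hy
    rcases Finset.mem_union.1 hy with hy | hy
    · obtain ⟨c, hc, rfl⟩ := Finset.mem_image.1 hy
      rw [Finset.mem_range] at hc
      refine ⟨hout c hc (by omega), h.lt c (by omega), .inl ?_⟩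
      rwa [h.invol c (by omega)]
    · obtain ⟨i, hi, rfl⟩ := Finset.mem_image.1 hy
      rw [hL] at hi
      have h1 := (hA i hi.2.1).1 hi.2.2
      have h2 := h.invol i (by omega)
      rw [h1] at h2
      exact ⟨by omega, hi.2.1, .inr ⟨by omega, by omega⟩⟩

/-- Of the pairs of such a family, those with smaller larger element are all nested in a given
one, or they all lie entirely below it. -/
lemma IsNoncrossingMatching.nested_or_below (h : IsNoncrossingMatching N π) {Y : Finset ℕ}
    (hY : ∀ y ∈ Y, D ≤ y ∧ y < N ∧ (π y < D ∨ D ≤ π y ∧ π y + 1 = y)) {y : ℕ} (hy : y ∈ Y) :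
    (∀ y' ∈ Y, y' < y → π y < π y') ∨ ∀ y' ∈ Y, y' < y → y' < π y := by
  obtain ⟨-, hyN, hπ⟩ := hY y hy
  rcases hπ with hπ | hπ
  · refine .inl fun y' hy' hlt => ?_
    obtain ⟨hyD', hyN', -⟩ := hY y' hy'
    by_contra! hle
    have hne : π y' ≠ π y := fun h' => hlt.ne (h.inj hyN' hyN h')
    refine h.noncrossing (π y') (π y) (by omega) (by omega) ?_ ?_ <;> rw [h.invol y' hyN']
    · omega
    · rwa [h.invol y hyN]
  · refine .inr fun y' hy' hlt => ?_
    obtain ⟨hyD', hyN', hπ'⟩ := hY y' hy'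
    have hne : y' ≠ π y := fun h' => by
      have := h.invol y hyN
      rw [← h'] at this
      omega
    omega

end Matching

/-! ### Alternating paths among segments in convex position -/

section Path

variable {n : ℕ} {a b : Fin n → Plane}

/-- The index of the segment that has the given endpoint. -/
abbrev segmentIndex (y : Fin n ⊕ Fin n) : Fin n := Sum.elim id id y

lemma endpoints_eq (y : Fin n ⊕ Fin n) :
    s(Sum.elim a b y, Sum.elim a b y.swap) = s(a (segmentIndex y), b (segmentIndex y)) := by
  cases y with
  | inl i => rfl
  | inr i => exact Sym2.eq_swap

lemma segment_endpoints_eq (y : Fin n ⊕ Fin n) :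
    segment ℝ (Sum.elim a b y) (Sum.elim a b y.swap) =
      segment ℝ (a (segmentIndex y)) (b (segmentIndex y)) := by
  cases y with
  | inl i => rfl
  | inr i => exact segment_symm ℝ _ _

lemma eq_or_eq_swap_of_segmentIndex_eq {y z : Fin n ⊕ Fin n}
    (h : segmentIndex y = segmentIndex z) : y = z ∨ y = z.swap := by
  cases y <;> cases z <;> simp_all [segmentIndex]

/-- Disjoint segments match the points on the convex hull without crossing. -/
lemma IsConvexSegmentFamily.exists_matching (h : IsConvexSegmentFamily a b) {N : ℕ}
    {q : ℕ → Fin n ⊕ Fin n} (hq : IsCyclicOrder (Sum.elim a b) N q) :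
    ∃ π, IsNoncrossingMatching N π ∧ ∀ i, q (π i) = (q i).swap := by
  choose π hlt hπ using fun i => hq.surj (q i).swap
  refine ⟨π, ⟨fun i _ => hlt i, fun i hi => ?_, fun i hi h' => ?_,
    fun i j hj hij hjπ hππ => ?_⟩, hπ⟩
  · refine hq.inj _ _ (hlt _) hi ?_
    rw [hπ, hπ, Sum.swap_swap]
  · have := hπ i
    rw [h'] at this
    cases hqi : q i <;> simp [hqi] at this
  · have hcross := not_disjoint_diagonals (hq.orient_pos i j (π i) hij hjπ (hlt i))
      (hq.orient_pos i (π i) (π j) (by omega) hππ (hlt j))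
      (hq.orient_pos i j (π j) hij (by omega) (hlt j))
      (hq.orient_pos j (π i) (π j) hjπ hππ (hlt j))
    rw [hπ, hπ, segment_endpoints_eq, segment_endpoints_eq] at hcross
    refine hcross (h.disjoint _ _ fun h' => ?_)
    rcases eq_or_eq_swap_of_segmentIndex_eq h' with h' | h'
    · have := hq.inj _ _ (by omega) hj h'
      omega
    · have h1 : q (π i) = q j := by rw [hπ, h', Sum.swap_swap]
      have := hq.inj _ _ (hlt i) hj h1
      omega

/-- The signs of the orientation of points in cyclic order. -/
lemma IsCyclicOrder.orient_signs {ι : Type} {P : ι → Plane} {N : ℕ} {q : ℕ → ι}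
    (hq : IsCyclicOrder P N q) {x y w : ℕ} (hxy : x < y) (hy : y < N) :
    (x < w → w < y → orient (P (q x)) (P (q y)) (P (q w)) < 0) ∧
      (w < x → 0 < orient (P (q x)) (P (q y)) (P (q w))) := by
  refine ⟨fun h1 h2 => ?_, fun h => ?_⟩
  · rw [orient_swap]
    have := hq.orient_pos _ _ _ h1 h2 hy
    linarith
  · rw [orient_rotate]
    exact hq.orient_pos _ _ _ h hxy hy

/-- If, for each matched pair of a sequence, all later ones are nested in it or all later ones lie
below it, then traversing the pairs in this order, each from its larger to its smaller element,
yields an alternating path. -/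
lemma admitsAlternatingPath_of_sequence (hinj : Function.Injective (Sum.elim a b)) {N : ℕ}
    {q : ℕ → Fin n ⊕ Fin n}
    (hq : IsCyclicOrder (Sum.elim a b) N q) {π : ℕ → ℕ} (hπ : ∀ i, q (π i) = (q i).swap)
    {k : ℕ} {y : ℕ → ℕ} (hyN : ∀ t < k, y t < N) (hπy : ∀ t < k, π (y t) < y t)
    (hy : ∀ t < k, (∀ u, t < u → u < k → π (y t) < π (y u) ∧ y u < y t) ∨
      ∀ u, t < u → u < k → y u < π (y t)) :
    AdmitsAlternatingPath a b k := by
  classical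
  let z : ℕ → ℕ := fun i => if i % 2 = 0 then y (i / 2) else π (y (i / 2))
  have hz0 : ∀ t, z (2 * t) = y t := fun t => by simp [z]
  have hz1 : ∀ t, z (2 * t + 1) = π (y t) := fun t => by
    have h1 : (2 * t + 1) % 2 = 1 := by omega
    have h2 : (2 * t + 1) / 2 = t := by omega
    simp [z, h1, h2]
  have hz : ∀ s, z s = y (s / 2) ∨ z s = π (y (s / 2)) := fun s => by
    simp only [z]
    split_ifs <;> simp
  set P : Fin n ⊕ Fin n → Plane := Sum.elim a b with hP
  -- The later positions lie all between the ends of an edge of the path, or all below both.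
  have hside : ∀ i, i < 2 * k - 1 → ∃ x y, x < y ∧ y < N ∧
      (x = z i ∧ y = z (i + 1) ∨ y = z i ∧ x = z (i + 1)) ∧
      ((∀ s, i + 1 < s → s ≤ 2 * k - 1 → x < z s ∧ z s < y) ∨
        ∀ s, i + 1 < s → s ≤ 2 * k - 1 → z s < x) := by
    intro i hi
    rcases Nat.even_or_odd' i with ⟨t, rfl | rfl⟩
    · have ht : t < k := by omega
      refine ⟨π (y t), y t, hπy t ht, hyN t ht, .inr ⟨(hz0 t).symm, (hz1 t).symm⟩,
        (hy t ht).imp (fun h s hs hs' => ?_) (fun h s hs hs' => ?_)⟩ <;>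
      · have h1 := h (s / 2) (by omega) (by omega)
        have h2 := hπy (s / 2) (by omega)
        rcases hz s with h | h <;> omega
    · have ht : t + 1 < k := by omega
      have hlow : ∀ s, 2 * t + 1 + 1 < s → s ≤ 2 * k - 1 → z s < y (t + 1) := by
        intro s hs hs'
        have h1 := hπy (t + 1) ht
        by_cases hs2 : s = 2 * (t + 1) + 1
        · rw [hs2, hz1]
          exact h1
        · have h2 := hπy (s / 2) (by omega)
          have h3 : y (s / 2) < y (t + 1) := by
            rcases hy (t + 1) ht with h | h
            · exact (h (s / 2) (by omega) (by omega)).2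
            · exact (h (s / 2) (by omega) (by omega)).trans h1
          rcases hz s with h | h <;> omega
      have h1 := hπy (t + 1) ht
      have hz2 : z (2 * t + 1 + 1) = y (t + 1) := hz0 (t + 1)
      rcases hy t (by omega) with h | h
      · have h2 := h (t + 1) (by omega) ht
        refine ⟨π (y t), y (t + 1), by omega, hyN _ ht, .inl ⟨(hz1 t).symm, hz2.symm⟩,
          .inl fun s hs hs' => ⟨?_, hlow s hs hs'⟩⟩
        have h3 := h (s / 2) (by omega) (by omega)
        have h4 := hπy (s / 2) (by omega)
        rcases hz s with h | h <;> omega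
      · exact ⟨y (t + 1), π (y t), h (t + 1) (by omega) ht,
          (hπy t (by omega)).trans (hyN t (by omega)), .inr ⟨(hz1 t).symm, hz2.symm⟩, .inr hlow⟩
  refine ⟨fun i => P (q (z i)), 2 * k - 1, 0, isSimpleChain_of_orient ?_ ?_, ?_, ?_⟩
  · intro i hi
    obtain ⟨x, y, hxy, hyN, h, -⟩ := hside i hi
    have hne : P (q x) ≠ P (q y) := fun h' =>
      hxy.ne (hq.inj _ _ (hxy.trans hyN) hyN (hinj h'))
    rcases h with ⟨rfl, rfl⟩ | ⟨rfl, rfl⟩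
    · exact hne
    · exact hne.symm
  · intro i hi
    obtain ⟨x, y, hxy, hyN, h, h'⟩ := hside i hi
    have hsign := fun w => hq.orient_signs (w := w) hxy hyN
    rcases h with ⟨rfl, rfl⟩ | ⟨rfl, rfl⟩ <;> rcases h' with h' | h'
    · refine ⟨-1, fun j hj hj' => ?_⟩
      have := (hsign (z j)).1 (h' j hj hj').1 (h' j hj hj').2
      linarith
    · refine ⟨1, fun j hj hj' => ?_⟩
      have := (hsign (z j)).2 (h' j hj hj')
      linarith
    · refine ⟨1, fun j hj hj' => ?_⟩
      have := (hsign (z j)).1 (h' j hj hj').1 (h' j hj hj').2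
      rw [orient_flip] at this
      linarith
    · refine ⟨-1, fun j hj hj' => ?_⟩
      have := (hsign (z j)).2 (h' j hj hj')
      rw [orient_flip] at this
      linarith
  · intro i _ heven
    obtain ⟨t, rfl⟩ : ∃ t, i = 2 * t := (even_iff_two_dvd.1 (by simpa using heven))
    simp only [hz0, hz1, hπ]
    exact ⟨_, endpoints_eq _⟩
  · have : {i ∈ Finset.range (2 * k - 1) | Even (i + 0)} = (Finset.range k).image (2 * ·) := by
      ext i
      simp only [Finset.mem_filter, Finset.mem_range, Finset.mem_image, add_zero,
        even_iff_two_dvd]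
      constructor
      · rintro ⟨hi, t, rfl⟩
        exact ⟨t, by omega, rfl⟩
      · rintro ⟨t, ht, rfl⟩
        exact ⟨by omega, t, rfl⟩
    rw [this, Finset.card_image_of_injective _ (mul_right_injective₀ two_ne_zero),
      Finset.card_range]

/-- Segments with endpoints in convex position admit an alternating path through `k` of them if
`d + l - 2 ≥ k` for all `d` and `l` with `2 n ≤ d l`. -/
lemma IsConvexSegmentFamily.admitsAlternatingPath {k : ℕ} (h : IsConvexSegmentFamily a b)
    (hn : 1 ≤ n) (hk : ∀ d l, 2 * n ≤ d * (l + 2) → k ≤ d + l) : AdmitsAlternatingPath a b k := by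
  classical
  have hN : Fintype.card (Fin n ⊕ Fin n) = 2 * n := by
    rw [Fintype.card_sum, Fintype.card_fin]; ring
  obtain ⟨q₀, hq₀⟩ := h.convex_position.exists_isCyclicOrder (.inl ⟨0, hn⟩)
  rw [hN] at hq₀
  have hex : ∃ D, ∀ x, ∃ j < D, q₀ (x + j + 1) = (q₀ (x + j)).swap := by
    refine ⟨2 * n, fun x => ?_⟩
    obtain ⟨π, hm, hπ⟩ := h.exists_matching (hq₀.shift x)
    obtain ⟨c, -, hc, hcc⟩ := hm.exists_adjacent 0 (by omega)
      (Nat.pos_of_ne_zero (hm.ne 0 (by omega)))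
    refine ⟨c, hc.trans (hm.lt 0 (by omega)), ?_⟩
    have h1 := hπ c
    rwa [hcc, Nat.add_right_comm, Nat.add_comm c x] at h1
  obtain ⟨D, hD, hmin⟩ : ∃ D, (∀ x, ∃ j < D, q₀ (x + j + 1) = (q₀ (x + j)).swap) ∧
      ∀ D' < D, ¬ ∀ x, ∃ j < D', q₀ (x + j + 1) = (q₀ (x + j)).swap :=
    ⟨Nat.find hex, Nat.find_spec hex, fun _ => Nat.find_min hex⟩
  have hD0 : 0 < D := by
    obtain ⟨j, hj, -⟩ := hD 0
    omega
  obtain ⟨x, hx⟩ := not_forall.1 (hmin (D - 1) (by omega))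
  push Not at hx
  -- Start the cyclic order where `D - 1` consecutive positions do not contain neighbours.
  have hq := hq₀.shift x
  obtain ⟨π, hm, hπ⟩ := h.exists_matching hq
  let A : ℕ → Prop := fun i => q₀ (i + x + 1) = (q₀ (i + x)).swap
  have hper : ∀ i, A (i + 2 * n) ↔ A i := by
    intro i
    have h1 : i + 2 * n + x + 1 = (i + x + 1) + 2 * n := by omega
    have h2 : i + 2 * n + x = (i + x) + 2 * n := by omega
    simp only [A]
    rw [h1, h2, hq₀.periodic, hq₀.periodic]
  have hA : ∀ i, i + 1 < 2 * n → (A i ↔ π i = i + 1) := by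
    intro i hi
    have h1 : i + x + 1 = i + 1 + x := by omega
    simp only [A]
    rw [h1, ← hπ i]
    exact ⟨fun h' => (hq.inj _ _ hi (hm.lt i (by omega)) h').symm, fun h' => by rw [h']⟩
  have hDx : ∀ y, ∃ j < D, A (y + j) := by
    intro y
    obtain ⟨j, hj, hj'⟩ := hD (y + x)
    refine ⟨j, hj, ?_⟩
    simp only [A]
    rwa [Nat.add_right_comm y j x]
  have hrun : ∀ j, j + 1 < D → ¬ A j := by
    intro j hj
    simp only [A]
    rw [Nat.add_comm j x]
    exact hx j (by omega)
  obtain ⟨l, Y, hl, hcard, hY⟩ := hm.exists_large_family (by omega) hper hA hDx hrun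
  obtain ⟨Y', hY', hcard'⟩ := Finset.exists_subset_card_eq ((hk D l hl).trans hcard)
  let e := Y'.orderEmbOfFin hcard'
  have he : ∀ t, e t ∈ Y := fun t => hY' (Y'.orderEmbOfFin_mem hcard' t)
  let y : ℕ → ℕ := fun t => if ht : t < k then e (Fin.rev ⟨t, ht⟩) else 0
  have hyY : ∀ t < k, y t ∈ Y := fun t ht => by
    simp only [y, ht, dif_pos]
    exact he _
  have hanti : ∀ t u, t < u → u < k → y u < y t := fun t u htu hu => by
    have ht : t < k := htu.trans hu
    simp only [y, ht, hu, dif_pos]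
    exact e.lt_iff_lt.2 (Fin.rev_lt_rev.2 htu)
  refine admitsAlternatingPath_of_sequence h.convex_position.injective hq hπ (y := y)
    (fun t ht => (hY _ (hyY t ht)).2.1) (fun t ht => ?_) fun t ht => ?_
  · have := hY _ (hyY t ht)
    omega
  · refine (hm.nested_or_below hY (hyY t ht)).imp (fun h u htu hu => ?_) fun h u htu hu => ?_
    · exact ⟨h _ (hyY u hu) (hanti t u htu hu), hanti t u htu hu⟩
    · exact h _ (hyY u hu) (hanti t u htu hu)

end Path

/-! ### Segments between points of a parabola -/

/-- The point of the standard parabola with integer abscissa `t`. -/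
noncomputable def parabola (t : ℕ) : Plane := !₂[(t : ℝ), (t : ℝ) ^ 2]

lemma orient_parabola (x y z : ℕ) : orient (parabola x) (parabola y) (parabola z) =
    ((y : ℝ) - x) * ((z : ℝ) - x) * ((z : ℝ) - y) := by
  simp only [orient, parabola, PiLp.toLp_apply, Matrix.cons_val_zero, Matrix.cons_val_one]
  ring

lemma orient_parabola_pos {x y z : ℕ} (hxy : x < y) (hyz : y < z) :
    0 < orient (parabola x) (parabola y) (parabola z) := by
  rw [orient_parabola]
  have h1 : (x : ℝ) < y := Nat.cast_lt.2 hxy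
  have h2 : (y : ℝ) < z := Nat.cast_lt.2 hyz
  exact mul_pos (mul_pos (by linarith) (by linarith)) (by linarith)

lemma convexIndependent_parabola {ι : Type} {p : ι → ℕ} (hp : Function.Injective p) :
    ConvexIndependent ℝ fun i => parabola (p i) := by
  intro s x hx
  by_contra hxs
  -- The tangent at a point of the parabola separates it from the other points.
  have hconv : Convex ℝ {z : Plane | -(p x : ℝ) ^ 2 < z 1 - 2 * p x * z 0} := by
    refine convex_halfSpace_gt (IsLinearMap.mk (fun y z => ?_) fun c y => ?_) _
    · simp only [PiLp.add_apply]; ring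
    · simp only [PiLp.smul_apply, smul_eq_mul]; ring
  have hsub : (fun i => parabola (p i)) '' s ⊆
      {z : Plane | -(p x : ℝ) ^ 2 < z 1 - 2 * p x * z 0} := by
    rintro _ ⟨y, hy, rfl⟩
    have hne : (p y : ℝ) - p x ≠ 0 := by
      rw [sub_ne_zero]
      exact fun h => hxs (hp (Nat.cast_injective h) ▸ hy)
    have := pow_pos (abs_pos.2 hne) 2
    rw [sq_abs] at this
    simp only [parabola, Set.mem_ofPred_eq, Matrix.cons_val_zero, Matrix.cons_val_one]
    linarith
  have := convexHull_min hsub hconv hx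
  simp only [parabola, Set.mem_ofPred_eq, Matrix.cons_val_zero, Matrix.cons_val_one] at this
  linarith

lemma disjoint_chords_of_inside {x y z w : ℕ} (hz : x < z ∧ z < y) (hw : x < w ∧ w < y) :
    Disjoint (segment ℝ (parabola x) (parabola y)) (segment ℝ (parabola z) (parabola w)) := by
  have key : ∀ {z}, x < z → z < y → 0 < -1 * orient (parabola x) (parabola y) (parabola z) := by
    intro z h h'
    have := orient_parabola_pos h h'
    rw [orient_swap]
    linarith
  exact disjoint_segment_of_orient _ (key hz.1 hz.2) (key hw.1 hw.2)

lemma disjoint_chords_of_outside {x y z w : ℕ} (hxy : x < y) (hz : z < x ∨ y < z)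
    (hw : w < x ∨ y < w) :
    Disjoint (segment ℝ (parabola x) (parabola y)) (segment ℝ (parabola z) (parabola w)) := by
  have key : ∀ {z}, z < x ∨ y < z → 0 < 1 * orient (parabola x) (parabola y) (parabola z) := by
    intro z h
    rw [one_mul]
    rcases h with h | h
    · rw [orient_rotate]
      exact orient_parabola_pos h hxy
    · exact orient_parabola_pos hxy h
  exact disjoint_segment_of_orient _ (key hz) (key hw)

lemma not_disjoint_chords {x y z w : ℕ} (hz : x < z ∧ z < y) (hw : w < x ∨ y < w) :
    ¬ Disjoint (segment ℝ (parabola z) (parabola w)) (segment ℝ (parabola x) (parabola y)) := by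
  rcases hw with hw | hw
  · rw [segment_symm]
    exact not_disjoint_diagonals (orient_parabola_pos hw hz.1)
      (orient_parabola_pos (hw.trans hz.1) hz.2) (orient_parabola_pos hw (hz.1.trans hz.2))
      (orient_parabola_pos hz.1 hz.2)
  · rw [disjoint_comm]
    exact not_disjoint_diagonals (orient_parabola_pos hz.1 hz.2)
      (orient_parabola_pos (hz.1.trans hz.2) hw) (orient_parabola_pos hz.1 (hz.2.trans hw))
      (orient_parabola_pos hz.2 hw)

/-! ### Nested groups of segments -/

/-- The left end of the segment `v`: the segments are arranged next to each other in `l` groups of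
at most `r`, which are the residue classes modulo `l`; in each group the segments are nested, the
larger ones inside the smaller ones. This is the dual of a spider with `l` legs. -/
def leftEnd (l r v : ℕ) : ℕ := v % l * (2 * r) + v / l

/-- The right end of the segment `v`. -/
def rightEnd (l r v : ℕ) : ℕ := v % l * (2 * r) + (2 * r - 1 - v / l)

section Groups

variable {l r v w x : ℕ}

lemma leftEnd_lt_rightEnd (hv : v < l * r) : leftEnd l r v < rightEnd l r v := by
  have := Nat.div_lt_of_lt_mul hv
  simp only [leftEnd, rightEnd]
  omega

lemma div_lt_div_of_mod_eq (h : v % l = w % l) (hlt : v < w) : v / l < w / l := by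
  rw [← Nat.div_add_mod v l, ← Nat.div_add_mod w l, h] at hlt
  exact lt_of_mul_lt_mul_left (Nat.lt_of_add_lt_add_right hlt) (Nat.zero_le l)

lemma end_inside (hw : w < l * r) (h : v % l = w % l) (hlt : v < w)
    (hx : x = leftEnd l r w ∨ x = rightEnd l r w) : leftEnd l r v < x ∧ x < rightEnd l r v := by
  have h1 := Nat.div_lt_of_lt_mul hw
  have h2 := div_lt_div_of_mod_eq h hlt
  simp only [leftEnd, rightEnd, h] at hx ⊢
  omega

lemma end_outside (hv : v < l * r) (hw : w < l * r) (h : v % l = w % l → w < v)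
    (hx : x = leftEnd l r w ∨ x = rightEnd l r w) : x < leftEnd l r v ∨ rightEnd l r v < x := by
  have h1 := Nat.div_lt_of_lt_mul hv
  have h2 := Nat.div_lt_of_lt_mul hw
  have hmul : ∀ {i j : ℕ}, i < j → i * (2 * r) + 2 * r ≤ j * (2 * r) := fun {i j} hij => by
    rw [← Nat.succ_mul]
    exact Nat.mul_le_mul_right _ hij
  rcases lt_trichotomy (v % l) (w % l) with h3 | h3 | h3
  · have := hmul h3
    simp only [leftEnd, rightEnd] at hx ⊢
    generalize v / l = i at *
    generalize w / l = j at *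
    omega
  · have := div_lt_div_of_mod_eq h3.symm (h h3)
    simp only [leftEnd, rightEnd, h3] at hx ⊢
    omega
  · have := hmul h3
    simp only [leftEnd, rightEnd] at hx ⊢
    generalize v / l = i at *
    generalize w / l = j at *
    omega

lemma isConvexSegmentFamily_groups {n : ℕ} (hn : n ≤ l * r) :
    IsConvexSegmentFamily (fun v : Fin n => parabola (leftEnd l r v))
      (fun v : Fin n => parabola (rightEnd l r v)) := by
  have hlt : ∀ v : Fin n, v.val < l * r := fun v => v.2.trans_le hn
  have key : ∀ {v w : Fin n} {x : ℕ}, v ≠ w → (x = leftEnd l r v ∨ x = rightEnd l r v) →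
      (x = leftEnd l r w ∨ x = rightEnd l r w) → False := by
    intro v w x hne hv hw
    wlog hvw : v.val < w.val generalizing v w
    · exact this hne.symm hw hv (lt_of_le_of_ne (not_lt.1 hvw) fun h => hne (Fin.ext h.symm))
    by_cases h : v.val % l = w.val % l
    · have := end_inside (hlt w) h hvw hw
      omega
    · have := end_outside (hlt v) (hlt w) (fun h' => (h h').elim) hw
      have := leftEnd_lt_rightEnd (hlt v)
      omega
  refine ⟨?_, fun v w hvw => ?_⟩
  · have hinj : Function.Injective (Sum.elim (fun v : Fin n => leftEnd l r v)
        (fun v : Fin n => rightEnd l r v)) := by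
      have hends : ∀ v : Fin n, leftEnd l r v ≠ rightEnd l r v := fun v =>
        (leftEnd_lt_rightEnd (hlt v)).ne
      rintro (v | v) (w | w) h <;> simp only [Sum.elim_inl, Sum.elim_inr] at h <;>
        by_cases hvw : v = w
      · rw [hvw]
      · exact (key hvw (.inl rfl) (.inl h)).elim
      · exact (hends v (hvw ▸ h)).elim
      · exact (key hvw (.inl rfl) (.inr h)).elim
      · exact (hends w (hvw ▸ h.symm)).elim
      · exact (key hvw (.inr rfl) (.inl h)).elim
      · rw [hvw]
      · exact (key hvw (.inr rfl) (.inr h)).elim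
    convert convexIndependent_parabola hinj using 1
    ext1 y
    cases y <;> rfl
  · wlog h : v.val < w.val generalizing v w
    · exact (this w v hvw.symm
        (lt_of_le_of_ne (not_lt.1 h) fun h => hvw (Fin.ext h.symm))).symm
    by_cases h' : v.val % l = w.val % l
    · exact disjoint_chords_of_inside (end_inside (hlt w) h' h (.inl rfl))
        (end_inside (hlt w) h' h (.inr rfl))
    · exact disjoint_chords_of_outside (leftEnd_lt_rightEnd (hlt v))
        (end_outside (hlt v) (hlt w) (fun h => (h' h).elim) (.inl rfl))
        (end_outside (hlt v) (hlt w) (fun h => (h' h).elim) (.inr rfl))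

end Groups

/-- An alternating path through `k` segments gives a sequence of `k` different ones such that
consecutive ones have endpoints whose connection avoids the others. -/
lemma AdmitsAlternatingPath.exists_sequence {n k : ℕ} (hn : 1 ≤ n) {a b : Fin n → Plane}
    (h : AdmitsAlternatingPath a b k) :
    ∃ f : ℕ → Fin n, (∀ t < k, ∀ u < k, f t = f u → t = u) ∧
      ∀ t, t + 1 < k → ∃ p p', (p = a (f t) ∨ p = b (f t)) ∧
        (p' = a (f (t + 1)) ∨ p' = b (f (t + 1))) ∧
        ∀ u < k, u ≠ t → u ≠ t + 1 →
          Disjoint (segment ℝ p p') (segment ℝ (a (f u)) (b (f u))) := by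
  obtain ⟨v, m, s, hchain, hfam, hk⟩ := h
  have : Nonempty (Fin n) := ⟨⟨0, hn⟩⟩
  have hlt : ∀ t, t < k ↔ s % 2 + 2 * t < m := by
    have himage : {i ∈ Finset.range m | Even (i + s)} =
        (Finset.range ((m - s % 2 + 1) / 2)).image fun t => s % 2 + 2 * t := by
      ext i
      simp only [Finset.mem_filter, Finset.mem_range, Finset.mem_image, Nat.even_iff]
      constructor
      · rintro ⟨hi, h⟩
        exact ⟨(i - s % 2) / 2, by omega, by omega⟩
      · rintro ⟨t, ht, rfl⟩
        omega
    rw [himage, Finset.card_image_of_injective _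
      (fun t u (h : s % 2 + 2 * t = s % 2 + 2 * u) => by omega),
      Finset.card_range] at hk
    intro t
    omega
  have hf : ∀ t, ∃ j, t < k →
      s(v (s % 2 + 2 * t), v (s % 2 + 2 * t + 1)) = s(a j, b j) := by
    intro t
    by_cases ht : t < k
    · obtain ⟨j, hj⟩ := hfam (s % 2 + 2 * t) ((hlt t).1 ht) (by rw [Nat.even_iff]; omega)
      exact ⟨j, fun _ => hj⟩
    · exact ⟨Classical.arbitrary _, fun h => (ht h).elim⟩
  choose f hf using hf
  have hseg : ∀ t < k, segment ℝ (v (s % 2 + 2 * t)) (v (s % 2 + 2 * t + 1)) =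
      segment ℝ (a (f t)) (b (f t)) := by
    intro t ht
    rcases Sym2.eq_iff.1 (hf t ht) with ⟨h1, h2⟩ | ⟨h1, h2⟩
    · rw [h1, h2]
    · rw [h1, h2, segment_symm]
  have hne : ∀ t u, t < u → u < k → f t ≠ f u := by
    intro t u htu hu h
    have hd := hchain.disjoint (s % 2 + 2 * t) (s % 2 + 2 * u) (by omega) ((hlt u).1 hu)
    rw [hseg t (htu.trans hu), hseg u hu, h, disjoint_self] at hd
    exact (Set.nonempty_iff_ne_empty.1 ⟨_, left_mem_segment ℝ _ _⟩) hd
  refine ⟨f, fun t ht u hu h => ?_, fun t ht => ?_⟩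
  · rcases lt_trichotomy t u with h' | h' | h'
    · exact (hne t u h' hu h).elim
    · exact h'
    · exact (hne u t h' ht h.symm).elim
  · have h0 := (hlt (t + 1)).1 ht
    refine ⟨v (s % 2 + 2 * t + 1), v (s % 2 + 2 * (t + 1)), ?_, ?_, fun u hu hut hut' => ?_⟩
    · rcases Sym2.eq_iff.1 (hf t (by omega)) with ⟨-, h⟩ | ⟨-, h⟩
      · exact .inr h
      · exact .inl h
    · rcases Sym2.eq_iff.1 (hf (t + 1) ht) with ⟨h, -⟩ | ⟨h, -⟩
      · exact .inl h
      · exact .inr h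
    · rw [← hseg u hu]
      have h1 : s % 2 + 2 * (t + 1) = s % 2 + 2 * t + 1 + 1 := by omega
      rw [h1]
      rcases Nat.lt_or_ge u t with h | h
      · exact (hchain.disjoint (s % 2 + 2 * u) (s % 2 + 2 * t + 1) (by omega) (by omega)).symm
      · exact hchain.disjoint (s % 2 + 2 * t + 1) (s % 2 + 2 * u) (by omega) ((hlt u).1 hu)

/-- If an alternating path uses at least two segments of a group, then the innermost of them is at
an end of the path: only the next one can precede or follow it. -/
lemma alternatingPath_groups_le {n l r k : ℕ} (hn : 1 ≤ n) (hl : 1 ≤ l) (hr : 1 ≤ r)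
    (hnl : n ≤ l * r)
    (h : AdmitsAlternatingPath (fun v : Fin n => parabola (leftEnd l r v))
      (fun v : Fin n => parabola (rightEnd l r v)) k) : k + 2 ≤ 2 * r + l := by
  classical
  obtain ⟨f, hf, hpath⟩ := h.exists_sequence hn
  have hlt : ∀ v : Fin n, v.val < l * r := fun v => v.2.trans_le hnl
  let S : Finset ℕ := (Finset.range k).image fun t => (f t).val
  have hcard : S.card = k := by
    rw [Finset.card_image_of_injOn, Finset.card_range]
    intro t ht u hu htu
    exact hf t (Finset.mem_range.1 ht) u (Finset.mem_range.1 hu) (Fin.ext htu)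
  have hmem : ∀ t < k, (f t).val ∈ S := fun t ht =>
    Finset.mem_image_of_mem _ (Finset.mem_range.2 ht)
  rw [← hcard]
  refine card_add_two_le_of_legs (B := {(f 0).val % l, (f (k - 1)).val % l}) hr ?_
    Finset.card_le_two ?_ hl
  · intro v hv
    obtain ⟨t, -, rfl⟩ := Finset.mem_image.1 hv
    exact hlt _
  · intro j hj
    rw [Finset.mem_insert, Finset.mem_singleton, not_or] at hj
    by_contra! h2
    set F := {v ∈ S | v % l = j} with hF
    have hne : F.Nonempty := Finset.card_pos.1 (by omega)
    have hdF := F.max'_mem hne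
    have hne' : (F.erase (F.max' hne)).Nonempty :=
      Finset.card_pos.1 (by rw [Finset.card_erase_of_mem hdF]; omega)
    have heF := (F.erase (F.max' hne)).max'_mem hne'
    have hmax := fun v hv => (F.erase (F.max' hne)).le_max' v hv
    set e := (F.erase (F.max' hne)).max' hne' with he
    have hle := F.le_max' e (Finset.mem_of_mem_erase heF)
    set d := F.max' hne with hd
    rw [Finset.mem_erase] at heF
    have hed : e < d := lt_of_le_of_ne hle heF.1
    obtain ⟨hdS, hdj⟩ := Finset.mem_filter.1 hdF
    obtain ⟨heS, hej⟩ := Finset.mem_filter.1 heF.2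
    obtain ⟨t, ht, htd⟩ := Finset.mem_image.1 hdS
    obtain ⟨u, hu, hue⟩ := Finset.mem_image.1 heS
    rw [Finset.mem_range] at ht hu
    have htj : (f t).val % l = j := by rw [htd, hdj]
    have huj : (f u).val % l = j := by rw [hue, hej]
    have hut : u ≠ t := by
      rintro rfl
      omega
    have hin : ∀ {x}, x = leftEnd l r (f t) ∨ x = rightEnd l r (f t) →
        leftEnd l r (f u) < x ∧ x < rightEnd l r (f u) := fun hx =>
      end_inside (hlt _) (huj.trans htj.symm) (by omega) hx
    have hout : ∀ s < k, s ≠ t → s ≠ u → ∀ {x},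
        x = leftEnd l r (f s) ∨ x = rightEnd l r (f s) →
        x < leftEnd l r (f u) ∨ rightEnd l r (f u) < x := by
      intro s hs hst hsu x hx
      refine end_outside (hlt _) (hlt _) (fun h => ?_) hx
      have h1 : (f s).val ≤ e := by
        refine hmax _ (Finset.mem_erase.2 ⟨fun h' => hst (hf s hs t ht (Fin.ext ?_)),
          Finset.mem_filter.2 ⟨hmem s hs, ?_⟩⟩)
        · rw [h', htd]
        · rw [← h, huj]
      have h2 : (f s).val ≠ e := fun h' => hsu (hf s hs u hu (Fin.ext (h'.trans hue.symm)))
      omega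
    have hends : ∀ {p : Plane} {s}, (p = parabola (leftEnd l r (f s)) ∨
        p = parabola (rightEnd l r (f s))) →
        ∃ x, p = parabola x ∧ (x = leftEnd l r (f s) ∨ x = rightEnd l r (f s)) := by
      rintro p s (rfl | rfl)
      · exact ⟨_, rfl, .inl rfl⟩
      · exact ⟨_, rfl, .inr rfl⟩
    have ht0 : t ≠ 0 := by
      rintro rfl
      exact hj.1 htj.symm
    have htk : t ≠ k - 1 := by
      intro h
      rw [← h] at hj
      exact hj.2 htj.symm
    have hnext : u = t + 1 := by
      by_contra hu'
      obtain ⟨p, p', hp, hp', hdis⟩ := hpath t (by omega)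
      obtain ⟨x, rfl, hx⟩ := hends hp
      obtain ⟨x', rfl, hx'⟩ := hends hp'
      exact not_disjoint_chords (hin hx)
        (hout (t + 1) (by omega) (by omega) (Ne.symm hu') hx') (hdis u hu hut hu')
    have hprev : u = t - 1 := by
      by_contra hu'
      obtain ⟨s, rfl⟩ : ∃ s, t = s + 1 := ⟨t - 1, by omega⟩
      obtain ⟨p, p', hp, hp', hdis⟩ := hpath s (by omega)
      obtain ⟨x, rfl, hx⟩ := hends hp
      obtain ⟨x', rfl, hx'⟩ := hends hp'
      have h1 := hdis u hu (by omega) hut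
      rw [segment_symm] at h1
      exact not_disjoint_chords (hin hx') (hout s (by omega) (by omega) (by omega) hx) h1
    omega

/-! ### The extremal number -/

lemma le_of_two_mul_le {n d l : ℕ} (h : 2 * n ≤ d * (l + 2)) :
    ⌈√(8 * (n : ℝ)) - 2⌉₊ ≤ d + l := by
  rw [Nat.ceil_le, sub_le_iff_le_add]
  refine Real.sqrt_le_iff.2 ⟨by positivity, ?_⟩
  have h' : 2 * (n : ℝ) ≤ d * (l + 2) := by exact_mod_cast h
  push_cast
  nlinarith [sq_nonneg ((d : ℝ) - (l + 2))]

/-- The number of legs of the extremal spider and their length. -/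
lemma exists_legs (n : ℕ) (hn : 1 ≤ n) : ∃ l r : ℕ, 1 ≤ l ∧ 1 ≤ r ∧ n ≤ l * r ∧
    ∀ k, k + 2 ≤ 2 * r + l → k ≤ ⌈√(8 * (n : ℝ)) - 2⌉₊ := by
  set s := ⌈√(8 * (n : ℝ)) - 2⌉₊ + 2 with hs
  have hle : √(8 * (n : ℝ)) ≤ s := by
    have := Nat.le_ceil (√(8 * (n : ℝ)) - 2)
    rw [hs]
    push_cast
    linarith
  have h8 : 8 * n ≤ s ^ 2 := by
    have := (Real.sqrt_le_iff.1 hle).2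
    exact_mod_cast this
  have hs3 : 3 ≤ s := by
    by_contra! h
    interval_cases s <;> omega
  -- The product `l * r` with `l + 2 * r = s` is largest for `r` closest to `s / 4`.
  have hmul : n ≤ (s - 2 * ((s + 1) / 4)) * ((s + 1) / 4) := by
    obtain ⟨t, ht⟩ : ∃ t, t = (s + 1) / 4 := ⟨_, rfl⟩
    rw [← ht]
    have : s + 1 = 4 * t ∨ s = 4 * t ∨ s = 4 * t + 1 ∨ s = 4 * t + 2 := by omega
    rcases this with h | h | h | h
    · obtain ⟨u, rfl⟩ : ∃ u, t = u + 1 := ⟨t - 1, by omega⟩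
      have h1 : s = 4 * u + 3 := by omega
      have h2 : s - 2 * (u + 1) = 2 * u + 1 := by omega
      rw [h2]
      rw [h1] at h8
      nlinarith
    · have h2 : s - 2 * t = 2 * t := by omega
      rw [h2]
      rw [h] at h8
      nlinarith
    · have h2 : s - 2 * t = 2 * t + 1 := by omega
      rw [h2]
      rw [h] at h8
      nlinarith
    · have h2 : s - 2 * t = 2 * t + 2 := by omega
      rw [h2]
      rw [h] at h8
      nlinarith
  exact ⟨s - 2 * ((s + 1) / 4), (s + 1) / 4, by omega, by omega, hmul, fun k hk => by omega⟩

theorem theorem1 (n : ℕ) (hn : 1 ≤ n) :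
    IsGreatest {k : ℕ | ∀ a b : Fin n → Plane, IsConvexSegmentFamily a b →
        AdmitsAlternatingPath a b k} ⌈√(8 * (n : ℝ)) - 2⌉₊ ∧
      IsGreatest {k : ℕ | ∀ (V : Type) [Finite V] (T : SimpleGraph V), T.IsTree →
        T.edgeSet.ncard = n → ContractsToCaterpillar T k} ⌈√(8 * (n : ℝ)) - 2⌉₊ := by
  obtain ⟨l, r, hl, hr, hlr, hmax⟩ := exists_legs n hn
  refine ⟨⟨fun a b h => h.admitsAlternatingPath hn fun d l => le_of_two_mul_le, fun k hk => ?_⟩,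
    ⟨fun V _ T hT hTn => contractsToCaterpillar_of_forall hT fun d l h => ?_, fun k hk => ?_⟩⟩
  · exact hmax k (alternatingPath_groups_le hn hl hr hlr
      (hk _ _ (isConvexSegmentFamily_groups hlr)))
  · rw [hTn] at h
    exact le_of_two_mul_le h
  · exact hmax k (spider_caterpillar_le hl hr hlr
      (hk _ (spider n l) (spider_isTree hl) (spider_ncard_edgeSet hl)))
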